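/- Let $X_n$ be one of the Dynkin types $A_n$ ($n\ge 1$), $D_n$ ($n\ge 4$), $E_6$, $E_7$, $E_8$, let $\Phi$ be a root system of type $X_n$, and let $\mathfrak g$ be the split Lie algebra of type $X_n$ over $\mathbb F_4$ with a Chevalley basis: root elements $\mathfrak x_\alpha$ ($\alpha\in\Phi$) and elements $\mathfrak h_\alpha=[\mathfrak x_\alpha,\mathfrak x_{-\alpha}]$ such that the $\mathfrak x_\alpha$ ($\alpha\in\Phi$) and the $\mathfrak h_\alpha$ ($\alpha$ simple) form a basis of $\mathfrak g$; let $\mathfrak h$ be the span of the $\mathfrak h_\alpha$. Let $H\cong(\mathbb F_4^*)^n$ be the group of automorphisms of $\mathfrak g$ that fix $\mathfrak h$ pointwise and act on each $\mathbb F_4\mathfrak x_\alpha$ as a scalar. Let $W\cong W(X_n)$ be the group of automorphisms generated by the reflections $s_\alpha$ ($\alpha\in\Phi$), where $s_\alpha$ maps each $\mathfrak x_\beta$ to $\mathfrak x_{s_\alpha(\beta)}$. Let $G=H\!:\!W\cong 3^n\!:\!W(X_n)$, and let $D$ be the set of the $G$-conjugates of the reflections $s_\alpha$. For $d,e\in D$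 that do not commute, $\{d,e,d^e=e^d\}$ is called a line. Let $\mathcal A(D)$ be the $\mathbb F_2$-algebra with basis $D$ and bilinear product given by $d*e=d+e+f$ if $\{d,e,f\}$ is a line and $d*e=0$ if $d$ and $e$ commute. Let $\mathcal V(D)$ be the radical of the bilinear form on $\mathcal A(D)$ with $(d,e)=0$ if $d$ and $e$ commute and $(d,e)=1$ otherwise. For $\alpha\in\Phi$ and $\omega\in\mathbb F_4$ put $\bar\omega=\omega^2$ and $$x(\alpha,\omega)=\omega\,\mathfrak x_\alpha+\bar\omega\,\mathfrak x_{-\alpha}+\omega\bar\omega\,[\mathfrak x_\alpha,\mathfrak x_{-\alpha}],$$ and let $\mathfrak g_2$ be the Lie algebra over $\mathbb F_2$ generated by all the $x(\alpha,\omega)$. Then: 1. $D$ is a conjugacy class of $3$-transpositions in $G$: it is a single class of involutions of $G$, and $de$ has order $1$, $2$ or $3$ for all $d,e\in D$. 2. $\mathcal A(D)/\mathcal V(D)$, with the product induced from $\mathcal A(D)$, is a Lie algebra isomorphic to $\mathfrak g_2/Z(\mathfrak g_2)$. 3. $\mathfrak g_2$ has type $^2A_n$ (for $A_n$), $^2D_n$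 (for $D_n$, $n$ odd), $D_n$ (for $D_n$, $n$ even), $^2E_6$, $E_7$, $E_8$ respectively over $\mathbb F_2$. That is, $\mathfrak g_2$ is isomorphic over $\mathbb F_2$ to the algebra of fixed points in $\mathfrak g$ of the additive Lie bracket automorphism $\sigma$ with $\sigma(av)=a^2\sigma(v)$ for $a\in\mathbb F_4$ and $\sigma(\mathfrak x_{\pm\alpha})=\mathfrak x_{\pm\tau(\alpha)}$ for $\alpha$ simple. Here $\tau$ is the reversal of the diagram for $A_n$ (trivial if $n=1$), the interchange of the two end nodes $n-1,n$ for $D_n$ with $n$ odd, the nontrivial diagram automorphism for $E_6$, and trivial for $D_n$ with $n$ even, $E_7$ and $E_8$. -/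

import Mathlib

/-! ## Classes of 3-transpositions and their algebras -/

namespace ThreeTransposition

section Algebra

variable {Γ : Type*} [Group Γ]

/-- `D` is a conjugacy class of `3`-transpositions in the group `G`: it is a conjugacy class of `G`
consisting of involutions, and `d * e` has order `1`, `2` or `3` for all `d, e ∈ D`. -/
structure IsClass (G : Subgroup Γ) (D : Set Γ) : Prop where
  conj_class : ∃ s ∈ G, D = {d | ∃ g ∈ G, d = g * s * g⁻¹}
  order_eq_two : ∀ d ∈ D, orderOf d = 2
  order_mul : ∀ d ∈ D, ∀ e ∈ D,
    orderOf (d * e) = 1 ∨ orderOf (d * e) = 2 ∨ orderOf (d * e) = 3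

variable (D : Set Γ)

/-- `{d, e, f}` is a line of the Fischer space of `D`: the points `d` and `e` do not commute, and
`f = d ^ e = e ^ d`. -/
def IsLine (d e f : D) : Prop :=
  ¬ Commute (d : Γ) (e : Γ) ∧
    (f : Γ) = (e : Γ)⁻¹ * d * e ∧ (f : Γ) = (d : Γ)⁻¹ * e * d

/-- The underlying space `𝔽₂ D` of the `3`-transposition algebra `A(D)`: the finite subsets of `D`
under symmetric difference. -/
abbrev Alg : Type _ := D →₀ ZMod 2

open Classical in
/-- The product of two points of `D` in `A(D)`: it is `d + e + f` if `{d, e, f}` is a line (there is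
at most one such `f`), and `0` if there is no line through `d` and `e`. -/
noncomputable def pointMul (d e : D) : Alg D :=
  if h : ∃ f : D, IsLine D d e f then
    Finsupp.single d 1 + Finsupp.single e 1 + Finsupp.single h.choose 1
  else 0

/-- The bilinear product `*` of the `3`-transposition algebra `A(D)`. -/
noncomputable def mul : Alg D →ₗ[ZMod 2] Alg D →ₗ[ZMod 2] Alg D :=
  Finsupp.lift _ (ZMod 2) D fun d => Finsupp.lift _ (ZMod 2) D fun e => pointMul D d e

open Classical in
/-- The bilinear form on `A(D)` with `(d, e) = 0` if `d` and `e` commute, and `1` otherwise. -/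
noncomputable def form : Alg D →ₗ[ZMod 2] Alg D →ₗ[ZMod 2] ZMod 2 :=
  Finsupp.lift _ (ZMod 2) D fun d => Finsupp.lift _ (ZMod 2) D fun e =>
    if Commute (d : Γ) (e : Γ) then 0 else 1

/-- The vanishing ideal `V(D)`: the radical of the (symmetric) form on `A(D)`. -/
noncomputable def vanishing : Submodule (ZMod 2) (Alg D) :=
  LinearMap.ker (form D)

theorem pointMul_of_isLine {d e f : D} (h : IsLine D d e f) :
    pointMul D d e = Finsupp.single d 1 + Finsupp.single e 1 + Finsupp.single f 1 := by
  have h' : ∃ f : D, IsLine D d e f := ⟨f, h⟩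
  have hf : h'.choose = f := Subtype.ext (h'.choose_spec.2.1.trans h.2.1.symm)
  rw [pointMul, dif_pos h', hf]

theorem mul_single (d e : D) :
    mul D (Finsupp.single d 1) (Finsupp.single e 1) = pointMul D d e := by
  simp [mul]

open Classical in
theorem form_single (d e : D) :
    form D (Finsupp.single d 1) (Finsupp.single e 1) =
      if Commute (d : Γ) (e : Γ) then 0 else 1 := by
  simp [form]

end Algebra

/-! ## Simply laced Dynkin types -/

/-- The Dynkin types `A_n` (`n ≥ 1`), `D_n` (`n ≥ 4`), `E_6`, `E_7`, `E_8`. -/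
inductive DynkinType : Type
  | A (n : ℕ) (hn : 1 ≤ n)
  | D (n : ℕ) (hn : 4 ≤ n)
  | E6
  | E7
  | E8

namespace DynkinType

/-- The number of nodes of the Dynkin diagram. -/
def rank : DynkinType → ℕ
  | A n _ => n
  | D n _ => n
  | E6 => 6
  | E7 => 7
  | E8 => 8

/-- The Cartan matrix (nodes numbered from `0`, in the order of Bourbaki). -/
def cartan : (X : DynkinType) → Matrix (Fin X.rank) (Fin X.rank) ℤ
  | A n _ => CartanMatrix.A n
  | D n _ => CartanMatrix.D n
  | E6 => CartanMatrix.E₆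
  | E7 => CartanMatrix.E₇
  | E8 => CartanMatrix.E₈

/-- The diagram automorphism that defines the type of the form over `𝔽₂`: it is the reversal of the
diagram for `A_n` (giving `²A_n`; trivial if `n = 1`), the interchange of the two last nodes for
`D_n` with `n` odd (giving `²D_n`), the nontrivial diagram automorphism for `E_6` (giving `²E_6`),
and trivial in the remaining cases (giving the split types `D_n` with `n` even, `E_7`, `E_8`). -/
def twist : (X : DynkinType) → Equiv.Perm (Fin X.rank)
  | A n _ => (Fin.revPerm : Equiv.Perm (Fin n))
  | D n hn => if Odd n then
      (Equiv.swap ⟨n - 2, by omega⟩ ⟨n - 1, by omega⟩ : Equiv.Perm (Fin n)) else 1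
  | E6 => (Equiv.swap 0 5 * Equiv.swap 2 4 : Equiv.Perm (Fin 6))
  | E7 => 1
  | E8 => 1

end DynkinType

/-! ## Chevalley bases, the group `G`, the class `D` and the algebra `𝔤₂` -/

section Chevalley

variable {ι M N : Type*} [AddCommGroup M] [Module ℚ M] [AddCommGroup N] [Module ℚ N]

/-- The index of the negative of the `i`-th root. -/
def negIdx (P : RootPairing ι ℚ M N) (i : ι) : ι := P.reflectionPerm i i

theorem root_negIdx (P : RootPairing ι ℚ M N) (i : ι) :
    P.root (negIdx P i) = - P.root i := by
  simp [negIdx]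

/-- A numbering of the simple roots which shows that the base `b` is of Dynkin type `X`. -/
structure Numbering {P : RootPairing ι ℚ M N} [P.IsCrystallographic] (b : P.Base)
    (X : DynkinType) where
  /-- the `k`-th simple root -/
  node : Fin X.rank ≃ b.support
  cartanMatrix_eq : ∀ k l, b.cartanMatrix (node k) (node l) = X.cartan k l

/-- A Chevalley basis of a Lie algebra `𝔤` over `K`, for a simply laced crystallographic root system
`P` with base `b`: nonzero root elements `x i` and elements `h i` (one for each root, `h` being
additive on the coroots) such that all the `x i` together with the `h i` for simple `i` form a basis
of `𝔤`, and the brackets are the usual ones. In the simply laced case the structure constants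
`±(r + 1)` in `⁅x i, x j⁆ = ±(r + 1) x k`, for `root k = root i + root j`, are `±1`. The span of the
`h i` is the Cartan subalgebra and the line of `x i` is the root space of the `i`-th root. -/
structure ChevalleyBasis {P : RootPairing ι ℚ M N} [P.IsCrystallographic] (b : P.Base)
    (K 𝔤 : Type*) [Field K] [LieRing 𝔤] [LieAlgebra K 𝔤] where
  /-- the root elements -/
  x : ι → 𝔤
  /-- the elements of the Cartan subalgebra that belong to the coroots -/
  h : ι → 𝔤
  linearIndependent : LinearIndependent K (Sum.elim x fun i : b.support => h i)
  span_eq_top : Submodule.span K (Set.range (Sum.elim x fun i : b.support => h i)) = ⊤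
  h_add : ∀ i j k, P.coroot k = P.coroot i + P.coroot j → h k = h i + h j
  lie_h_h : ∀ i j, ⁅h i, h j⁆ = 0
  lie_h_x : ∀ i j, ⁅h i, x j⁆ = (P.pairingIn ℤ j i : K) • x j
  lie_x_neg : ∀ i, ⁅x i, x (negIdx P i)⁆ = h i
  lie_x_add : ∀ i j k, P.root k = P.root i + P.root j →
    ⁅x i, x j⁆ = x k ∨ ⁅x i, x j⁆ = - x k
  lie_x_zero : ∀ i j, P.root i + P.root j ≠ 0 → P.root i + P.root j ∉ Set.range P.root →
    ⁅x i, x j⁆ = 0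

namespace ChevalleyBasis

variable {P : RootPairing ι ℚ M N} [P.IsCrystallographic] {b : P.Base}
variable {K 𝔤 : Type*} [Field K] [LieRing 𝔤] [LieAlgebra K 𝔤]

/-- The automorphism group of the Lie algebra `𝔤` over `K`. -/
def autGroup (K 𝔤 : Type*) [Field K] [LieRing 𝔤] [LieAlgebra K 𝔤] :
    Subgroup (𝔤 ≃ₗ[K] 𝔤) where
  carrier := {g | ∀ u v : 𝔤, g ⁅u, v⁆ = ⁅g u, g v⁆}
  one_mem' := fun u v => rfl
  mul_mem' := by
    intro g g' hg hg' u v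
    simp only [Set.mem_ofPred_eq] at hg hg'
    simp [LinearEquiv.mul_apply, hg, hg']
  inv_mem' := by
    intro g hg u v
    simp only [Set.mem_ofPred_eq] at hg
    apply g.injective
    have key : ∀ w : 𝔤, g (g⁻¹ w) = w := fun w => g.apply_symm_apply w
    rw [hg, key, key, key]

variable (c : ChevalleyBasis b K 𝔤)

/-- The group `H`, isomorphic to `(Kˣ)ⁿ`: the automorphisms that fix the Cartan subalgebra pointwise
and act on each root space as a scalar. -/
def torus : Set (𝔤 ≃ₗ[K] 𝔤) :=
  {g | g ∈ autGroup K 𝔤 ∧ (∀ i, g (c.h i) = c.h i) ∧ ∀ i, ∃ a : K, g (c.x i) = a • c.x i}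

/-- The reflections in `W`: the automorphisms that permute the root elements `x j` in the same way
as the reflection in some root permutes the roots. (They exist in characteristic `2`, where all
structure constants `±1` are equal to `1`.) -/
def reflections : Set (𝔤 ≃ₗ[K] 𝔤) :=
  {g | g ∈ autGroup K 𝔤 ∧ ∃ i, ∀ j, g (c.x j) = c.x (P.reflectionPerm i j)}

/-- The group `G = H : W` of automorphisms of `𝔤`, where `H` is the torus and where `W`, generated
by the reflections, is a copy of the Weyl group. -/
def group : Subgroup (𝔤 ≃ₗ[K] 𝔤) :=
  Subgroup.closure (c.torus ∪ c.reflections)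

/-- The set `D` of the `G`-conjugates of the reflections in `W`. -/
def transpositions : Set (𝔤 ≃ₗ[K] 𝔤) :=
  {d | ∃ s ∈ c.reflections, ∃ g ∈ c.group, d = g * s * g⁻¹}

/-- The element `x(α, ω) = ω x_α + ω̄ x_{-α} + ω ω̄ [x_α, x_{-α}]` of `𝔤`, where `ω̄ = ω ^ 2`. -/
def rootElement (i : ι) (ω : K) : 𝔤 :=
  ω • c.x i + ω ^ 2 • c.x (negIdx P i) + (ω * ω ^ 2) • ⁅c.x i, c.x (negIdx P i)⁆

section Forms

variable [LieAlgebra (ZMod 2) 𝔤]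

/-- The Lie algebra `𝔤₂` over `𝔽₂` that the elements `x(α, ω)` generate. -/
def gTwo : LieSubalgebra (ZMod 2) 𝔤 :=
  LieSubalgebra.lieSpan (ZMod 2) 𝔤 {v | ∃ (i : ι) (ω : K), v = c.rootElement i ω}

/-- `σ` is the Frobenius map of `𝔤` twisted by the diagram automorphism `τ`: the bijection that
preserves sums and brackets, is semilinear for `a ↦ a ^ 2`, and maps the root elements of `±α` to
those of `±τ(α)` for every simple root `α`. -/
structure IsTwistedFrobenius (τ : Equiv.Perm b.support) (σ : 𝔤 ≃ₗ⁅ZMod 2⁆ 𝔤) : Prop where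
  map_smul : ∀ (a : K) (v : 𝔤), σ (a • v) = a ^ 2 • σ v
  map_x : ∀ i : b.support, σ (c.x i) = c.x (τ i)
  map_x_neg : ∀ i : b.support, σ (c.x (negIdx P i)) = c.x (negIdx P (τ i))

/-- The Lie algebra over `𝔽₂` of the fixed points of `σ`. If `σ` is the Frobenius map of `𝔤` twisted
by `τ`, this is the Lie algebra of type `X_n(2)` if `τ` is trivial, and of type `²X_n(2)` if `τ` has
order `2`. -/
def fixedPoints (σ : 𝔤 ≃ₗ⁅ZMod 2⁆ 𝔤) : LieSubalgebra (ZMod 2) 𝔤 where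
  carrier := {v | σ v = v}
  add_mem' := by
    intro u v hu hv
    simp only [Set.mem_ofPred_eq] at hu hv ⊢
    rw [map_add, hu, hv]
  zero_mem' := by simp
  smul_mem' := by
    intro a v hv
    simp only [Set.mem_ofPred_eq] at hv ⊢
    rw [map_smul, hv]
  lie_mem' := by
    intro u v hu hv
    change σ u = u at hu
    change σ v = v at hv
    change σ ⁅u, v⁆ = ⁅u, v⁆
    rw [LieEquiv.map_lie, hu, hv]

end Forms

end ChevalleyBasis

end Chevalley

end ThreeTransposition

/-!
Write `-1` for the map `α ↦ -α` of the root system. In characteristic `2` all structure constants of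
the Chevalley basis are `1`, so every automorphism `π` of the root system and every character `χ` of
the root lattice define an automorphism `x_α ↦ χ(α) x_{π(α)}` of `𝔤` (`mono`).

*The class `D`.* The conjugates of the reflections are the elements `refl α a`, for a root `α` and
`a ∈ K^*`, that interchange `a x_α` and `a⁻¹ x_{-α}` (`mem_transpositions_iff`); here
`refl (-α) a = refl α a⁻¹` is the only coincidence (`refl_eq_refl_iff`). The formula for the
conjugate of one of them by another shows that they commute or generate `S₃` (`conj_refl_comm`), and
they form one class since the Weyl group is transitive on the roots (`isClass`).

*The algebra `A(D)`.* The linear map `A(D) → 𝔤` that takes the point `refl α a` to `x(α, a)` is a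
homomorphism of algebras (`algMap_mul`) with image `𝔤₂` (`range_algMap`). It pulls the invariant
form of `𝔤` back to the form of `A(D)` (`algebraMap_form`), whose radical therefore consists of the
elements that are mapped to elements with no root components and on which all roots vanish. These
are exactly the elements that are mapped to the centre (`algMap_mem_center_iff`), and the
isomorphism `A(D) / V(D) ≃ 𝔤₂ / Z(𝔤₂)` follows.

*The type of `𝔤₂`.* The generators `x(α, ω)` are fixed by the Frobenius map of `𝔤` twisted by `-1`,
and `𝔤₂` is the full algebra of fixed points (`gTwo_eq_fixedPoints`). If `β` is a root and `π` an
automorphism of the root system with `π(β) = -β`, then the Frobenius maps twisted by `π` and by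
`s_β π` are conjugate under the root `SL₂` of `β` (`twistMap_conj`): this is an explicit case of
Lang's theorem. Hence `-1` may be replaced by `-∏ s_β`, for any set of pairwise orthogonal roots
`β` (`exists_twist_conj`). For each Dynkin type there are such roots for which `-∏ s_β` permutes the
simple roots as the diagram automorphism `τ` does (`Numbering.exists_orthogonal`). In type `A` these
are the roots `α_k + ⋯ + α_{n-1-k}`, in type `D` the roots `ε_k ± ε_{k+1}` for even `k`, and in type
`E` explicit sets of `4`, `7` and `8` roots.

The Lie-theoretic part works for any root system with symmetric Cartan integers (`IsSimplyLaced`)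
whose Weyl group is transitive on the roots (`IsWeylTransitive`); both properties follow from the
shape of the Dynkin diagrams (`Numbering.isWeylTransitive`, `Numbering.isSimplyLaced`).
-/

set_option linter.unusedSectionVars false

namespace ThreeTransposition

/-! ### Simply laced root systems -/

section Roots

variable {ι M N : Type*} [AddCommGroup M] [Module ℚ M] [AddCommGroup N] [Module ℚ N]
  (P : RootPairing ι ℚ M N) [P.IsCrystallographic]

/-- A crystallographic root system is simply laced if its Cartan integers are symmetric: all roots
have the same length in each component. -/
class IsSimplyLaced : Prop where
  symm : ∀ i j, P.pairingIn ℤ i j = P.pairingIn ℤ j i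

@[simp] theorem pairingIn_negIdx_left (i j : ι) :
    P.pairingIn ℤ (negIdx P i) j = - P.pairingIn ℤ i j :=
  P.pairingIn_reflectionPerm_self_left ℤ i j

@[simp] theorem pairingIn_negIdx_right (i j : ι) :
    P.pairingIn ℤ i (negIdx P j) = - P.pairingIn ℤ i j :=
  P.pairingIn_reflectionPerm_self_right ℤ i j

@[simp] theorem negIdx_negIdx (i : ι) : negIdx P (negIdx P i) = i := by
  apply P.root.injective
  simp [root_negIdx]

theorem root_reflectionPerm_int (i j : ι) :
    P.root (P.reflectionPerm j i) = P.root i - P.pairingIn ℤ i j • P.root j := by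
  rw [P.root_reflectionPerm, P.reflection_apply_root' ℤ]

theorem coroot_reflectionPerm_int (i j : ι) :
    P.coroot (P.reflectionPerm j i) = P.coroot i - P.pairingIn ℤ j i • P.coroot j := by
  rw [P.coroot_reflectionPerm, P.coreflection_apply_coroot, ← P.algebraMap_pairingIn ℤ]
  simp [Int.cast_smul_eq_zsmul]

theorem pairingIn_reflectionPerm_left (i j k : ι) :
    P.pairingIn ℤ (P.reflectionPerm j i) k =
      P.pairingIn ℤ i k - P.pairingIn ℤ i j * P.pairingIn ℤ j k := by
  have h : P.root (P.reflectionPerm j i) =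
      (1 : ℤ) • P.root i + (-P.pairingIn ℤ i j) • P.root j := by
    rw [root_reflectionPerm_int]; module
  rw [P.pairingIn_eq_add_of_root_eq_smul_add_smul h]
  simp [sub_eq_add_neg]

theorem pairingIn_reflectionPerm_right (i j k : ι) :
    P.pairingIn ℤ k (P.reflectionPerm j i) =
      P.pairingIn ℤ k i - P.pairingIn ℤ j i * P.pairingIn ℤ k j := by
  rw [P.pairingIn_reflectionPerm, pairingIn_reflectionPerm_left]; ring

theorem reflectionPerm_negIdx (i j : ι) :
    P.reflectionPerm (negIdx P i) j = P.reflectionPerm i j := by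
  apply P.root.injective
  rw [root_reflectionPerm_int, root_reflectionPerm_int, root_negIdx, pairingIn_negIdx_right]
  module

theorem reflectionPerm_apply_negIdx (i j : ι) :
    P.reflectionPerm i (negIdx P j) = negIdx P (P.reflectionPerm i j) := by
  apply P.root.injective
  rw [root_reflectionPerm_int, root_negIdx, root_negIdx, root_reflectionPerm_int,
    pairingIn_negIdx_left]
  module

theorem reflectionPerm_self_eq (i : ι) : P.reflectionPerm i i = negIdx P i := rfl

/-- A permutation of the roots is an automorphism of the root system if it preserves the Cartan
integers. For a simply laced system it then respects negatives, sums and reflections. -/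
def IsRootAut (π : Equiv.Perm ι) : Prop :=
  ∀ i j, P.pairingIn ℤ (π i) (π j) = P.pairingIn ℤ i j

variable {P}

theorem IsRootAut.one : IsRootAut P 1 := fun _ _ => rfl

theorem IsRootAut.mul {π ρ : Equiv.Perm ι} (hπ : IsRootAut P π) (hρ : IsRootAut P ρ) :
    IsRootAut P (π * ρ) := fun i j => (hπ _ _).trans (hρ i j)

theorem IsRootAut.inv {π : Equiv.Perm ι} (hπ : IsRootAut P π) : IsRootAut P π⁻¹ := fun i j => by
  rw [← hπ]; simp

variable (P) in
theorem isRootAut_reflectionPerm (k : ι) : IsRootAut P (P.reflectionPerm k) := fun i j => by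
  rw [P.pairingIn_reflectionPerm, P.reflectionPerm_self]

variable (P) in
/-- The permutation `α ↦ -α` of the roots. -/
def negPerm : Equiv.Perm ι := (Function.Involutive.toPerm (negIdx P) (negIdx_negIdx P))

@[simp] theorem negPerm_apply (i : ι) : negPerm P i = negIdx P i := rfl

variable (P) in
theorem isRootAut_negPerm : IsRootAut P (negPerm P) := fun i j => by simp

section SimplyLaced

variable [Finite ι] [P.IsReduced] [IsSimplyLaced P]

variable (P) in
theorem pairingIn_comm (i j : ι) : P.pairingIn ℤ i j = P.pairingIn ℤ j i := IsSimplyLaced.symm i j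

theorem pairingIn_eq_two_iff {i j : ι} : P.pairingIn ℤ i j = 2 ↔ i = j := by
  rw [← P.pairingIn_two_two_iff ℤ, pairingIn_comm P j i, and_self]

theorem pairingIn_eq_neg_two_iff {i j : ι} : P.pairingIn ℤ i j = -2 ↔ j = negIdx P i := by
  rw [← pairingIn_eq_two_iff (P := P), pairingIn_negIdx_right, pairingIn_comm P i j]; omega

variable (P) in
theorem pairingIn_mem (i j : ι) : P.pairingIn ℤ i j = 0 ∨ P.pairingIn ℤ i j = 1 ∨
    P.pairingIn ℤ i j = -1 ∨ P.pairingIn ℤ i j = 2 ∨ P.pairingIn ℤ i j = -2 := by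
  have h := P.pairingIn_pairingIn_mem_set_of_isCrystal_of_isRed i j
  rw [pairingIn_comm P j i] at h
  simp only [Set.mem_insert_iff, Set.mem_singleton_iff, Prod.mk.injEq] at h
  omega

/-- In a simply laced root system, the sum of two roots is a root if and only if their Cartan
integer is `-1`; it is then the image of one of them under the reflection in the other. -/
theorem root_add_iff {i j k : ι} : P.root k = P.root i + P.root j ↔
    P.pairingIn ℤ i j = -1 ∧ k = P.reflectionPerm j i := by
  constructor
  · intro h
    have key : ∀ l, P.pairingIn ℤ k l = P.pairingIn ℤ i l + P.pairingIn ℤ j l :=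
      fun l => P.pairingIn_eq_add_of_root_eq_add h
    have h1 := key k
    have h2 := key i
    have h3 := key j
    rw [P.pairingIn_same, pairingIn_comm P i k, pairingIn_comm P j k] at h1
    rw [P.pairingIn_same] at h2 h3
    have h4 := pairingIn_comm P i j
    have h5 : P.pairingIn ℤ i j = -1 := by omega
    refine ⟨h5, P.root.injective ?_⟩
    rw [root_reflectionPerm_int, h5, h]; module
  · rintro ⟨h, rfl⟩
    rw [root_reflectionPerm_int, h]; module

theorem coroot_add_iff {i j k : ι} : P.coroot k = P.coroot i + P.coroot j ↔
    P.pairingIn ℤ i j = -1 ∧ k = P.reflectionPerm j i := by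
  constructor
  · intro h
    have key : ∀ l, P.pairingIn ℤ l k = P.pairingIn ℤ l i + P.pairingIn ℤ l j := by
      intro l
      have := congrArg (P.root' l) h
      rw [map_add, P.root'_coroot_eq_pairing, P.root'_coroot_eq_pairing,
        P.root'_coroot_eq_pairing, ← P.algebraMap_pairingIn ℤ, ← P.algebraMap_pairingIn ℤ,
        ← P.algebraMap_pairingIn ℤ] at this
      simpa using mod_cast this
    have h1 := key k
    have h2 := key i
    have h3 := key j
    rw [P.pairingIn_same, pairingIn_comm P k i, pairingIn_comm P k j] at h1
    rw [P.pairingIn_same] at h2 h3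
    have h4 := pairingIn_comm P i j
    have h5 : P.pairingIn ℤ i j = -1 := by omega
    refine ⟨h5, P.coroot.injective ?_⟩
    rw [coroot_reflectionPerm_int, pairingIn_comm, h5, h]; module
  · rintro ⟨h, rfl⟩
    rw [coroot_reflectionPerm_int, pairingIn_comm, h]; module

theorem reflectionPerm_comm_of_neg_one {i j : ι} (h : P.pairingIn ℤ i j = -1) :
    P.reflectionPerm i j = P.reflectionPerm j i :=
  (root_add_iff.1 (show P.root (P.reflectionPerm i j) = P.root i + P.root j by
    rw [add_comm]; exact root_add_iff.2 ⟨by rw [pairingIn_comm, h], rfl⟩)).2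

theorem reflectionPerm_of_zero {i j : ι} (h : P.pairingIn ℤ i j = 0) :
    P.reflectionPerm j i = i := by
  apply P.root.injective
  rw [root_reflectionPerm_int, h]; simp

theorem reflectionPerm_of_one {i j : ι} (h : P.pairingIn ℤ i j = 1) :
    P.reflectionPerm i j = negIdx P (P.reflectionPerm j i) := by
  apply P.root.injective
  rw [root_negIdx, root_reflectionPerm_int, root_reflectionPerm_int, h, pairingIn_comm, h]
  module

theorem IsRootAut.negIdx {π : Equiv.Perm ι} (hπ : IsRootAut P π) (i : ι) :
    π (negIdx P i) = negIdx P (π i) := by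
  rw [← pairingIn_eq_neg_two_iff (P := P), hπ, pairingIn_eq_neg_two_iff]

theorem IsRootAut.reflectionPerm {π : Equiv.Perm ι} (hπ : IsRootAut P π) (i j : ι) :
    π (P.reflectionPerm j i) = P.reflectionPerm (π j) (π i) := by
  rw [← pairingIn_eq_two_iff (P := P), pairingIn_reflectionPerm_right, hπ, hπ, hπ,
    ← pairingIn_reflectionPerm_right, P.pairingIn_same]

/-- A function on the roots is even and additive if it is induced by a homomorphism from the coroot
lattice to a group in which its values have order dividing `2`. -/
structure IsEvenAdditive (P : RootPairing ι ℚ M N) [P.IsCrystallographic] {A : Type*}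
    [AddCommGroup A] (F : ι → A) : Prop where
  neg : ∀ i, F (negIdx P i) = F i
  add : ∀ i j, P.pairingIn ℤ i j = -1 → F (P.reflectionPerm j i) = F i + F j

/-- An even additive function on the roots is determined by its values on the simple roots. -/
theorem IsEvenAdditive.ext (b : P.Base) {A : Type*} [AddCommGroup A] {F G : ι → A}
    (hF : IsEvenAdditive P F) (hG : IsEvenAdditive P G) (h : ∀ i ∈ b.support, F i = G i) (i : ι) :
    F i = G i := by
  refine b.induction_add i (p := fun i => F i = G i) (fun i hi => ?_) h (fun i j k hk hi hj => ?_)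
  · exact (hF.neg i).trans (hi.trans (hG.neg i).symm)
  · obtain ⟨h1, rfl⟩ := root_add_iff.1 hk
    rw [hF.add _ _ h1, hG.add _ _ h1, hi, h j hj]

theorem IsEvenAdditive.comp {A : Type*} [AddCommGroup A] {F : ι → A} (hF : IsEvenAdditive P F)
    {π : Equiv.Perm ι} (hπ : IsRootAut P π) : IsEvenAdditive P (F ∘ π) where
  neg i := by simp [hπ.negIdx, hF.neg]
  add i j h := by
    have := hF.add (π i) (π j) (by rw [hπ, h])
    simpa [hπ.reflectionPerm] using this

/-- A multiplicative character on the roots: the restriction of a homomorphism from the root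
lattice to the units of `K`. -/
structure IsChar (P : RootPairing ι ℚ M N) [P.IsCrystallographic] {K : Type*} [Field K]
    (χ : ι → Kˣ) : Prop where
  neg : ∀ i, χ (negIdx P i) = (χ i)⁻¹
  add : ∀ i j, P.pairingIn ℤ i j = -1 → χ (P.reflectionPerm j i) = χ i * χ j

namespace IsChar

variable {K : Type*} [Field K] {χ ψ : ι → Kˣ}

theorem one : IsChar P (1 : ι → Kˣ) := ⟨by simp, by simp⟩

theorem mul (hχ : IsChar P χ) (hψ : IsChar P ψ) : IsChar P (χ * ψ) where
  neg i := by simp [hχ.neg, hψ.neg, mul_comm]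
  add i j h := by simp [hχ.add i j h, hψ.add i j h, mul_mul_mul_comm]

theorem inv (hχ : IsChar P χ) : IsChar P χ⁻¹ where
  neg i := by simp [hχ.neg]
  add i j h := by simp [hχ.add i j h, mul_comm]

theorem comp (hχ : IsChar P χ) {π : Equiv.Perm ι} (hπ : IsRootAut P π) : IsChar P (χ ∘ π) where
  neg i := by simp [hπ.negIdx, hχ.neg]
  add i j h := by
    have := hχ.add (π i) (π j) (by rw [hπ, h])
    simpa [hπ.reflectionPerm] using this

theorem reflectionPerm (hχ : IsChar P χ) (i j : ι) :
    χ (P.reflectionPerm j i) = χ i * χ j ^ (-P.pairingIn ℤ i j) := by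
  rcases pairingIn_mem P i j with h | h | h | h | h
  · simp [reflectionPerm_of_zero h, h]
  · have h1 : P.pairingIn ℤ i (negIdx P j) = -1 := by simp [h]
    have := hχ.add _ _ h1
    rw [reflectionPerm_negIdx, hχ.neg] at this
    simp [this, h]
  · simpa [h] using hχ.add _ _ h
  · obtain rfl := pairingIn_eq_two_iff.1 h
    rw [reflectionPerm_self_eq, hχ.neg, h]
    group
  · obtain rfl := pairingIn_eq_neg_two_iff.1 h
    rw [reflectionPerm_negIdx, reflectionPerm_self_eq, hχ.neg, h]
    group

/-- The character `β ↦ a ^ ⟨β, α⟩` defined by a root `α`. -/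
theorem zpow_pairingIn (a : Kˣ) (i : ι) : IsChar P fun j => a ^ P.pairingIn ℤ j i where
  neg j := by simp
  add j k h := by
    rw [pairingIn_reflectionPerm_left, h, ← zpow_add]; ring_nf

end IsChar

end SimplyLaced

end Roots

namespace ChevalleyBasis

/-! ### Linear maps on a simply laced Chevalley algebra in characteristic two -/

variable {ι M N : Type*} [AddCommGroup M] [Module ℚ M] [AddCommGroup N] [Module ℚ N]
  {P : RootPairing ι ℚ M N} [P.IsCrystallographic] {b : P.Base}
  {K 𝔤 : Type*} [Field K] [LieRing 𝔤] [LieAlgebra K 𝔤] (c : ChevalleyBasis b K 𝔤)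

/-- The basis of `𝔤` that consists of the root elements and of the `h i` for simple `i`. -/
noncomputable def basis : Module.Basis (ι ⊕ b.support) K 𝔤 :=
  Module.Basis.mk c.linearIndependent c.span_eq_top.ge

@[simp] theorem basis_inl (i : ι) : c.basis (Sum.inl i) = c.x i := by simp [basis]

@[simp] theorem basis_inr (i : b.support) : c.basis (Sum.inr i) = c.h i := by simp [basis]

theorem x_ne_zero (i : ι) : c.x i ≠ 0 := by
  simpa using c.basis.ne_zero (Sum.inl i)

theorem induction {p : 𝔤 → Prop} (zero : p 0) (x : ∀ i, p (c.x i)) (h : ∀ i, p (c.h i))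
    (add : ∀ u v, p u → p v → p (u + v)) (smul : ∀ (a : K) v, p v → p (a • v)) (v : 𝔤) : p v := by
  have hv : v ∈ Submodule.span K (Set.range (Sum.elim c.x fun i : b.support => c.h i)) := by
    rw [c.span_eq_top]; trivial
  induction hv using Submodule.span_induction with
  | mem v hv =>
    obtain ⟨i | i, rfl⟩ := hv
    exacts [x i, h i]
  | zero => exact zero
  | add u v _ _ hu hv => exact add u v hu hv
  | smul a v _ hv => exact smul a v hv

theorem linearMap_ext {L : Type*} [Field L] {θ : K →+* L} {V : Type*} [AddCommGroup V] [Module L V]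
    {f g : 𝔤 →ₛₗ[θ] V} (x : ∀ i, f (c.x i) = g (c.x i)) (h : ∀ i, f (c.h i) = g (c.h i)) :
    f = g := by
  ext v
  exact c.induction (p := fun v => f v = g v) (by simp) x h
    (fun u v hu hv => by rw [map_add, map_add, hu, hv])
    (fun a v hv => by rw [map_smulₛₗ, map_smulₛₗ, hv]) v

/-- A semilinear map that preserves the brackets of the root elements and of the `h i` preserves
all brackets. -/
theorem map_lie_of_basis {θ : K →+* K} (f : 𝔤 →ₛₗ[θ] 𝔤)
    (hxx : ∀ i j, f ⁅c.x i, c.x j⁆ = ⁅f (c.x i), f (c.x j)⁆)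
    (hhx : ∀ i j, f ⁅c.h i, c.x j⁆ = ⁅f (c.h i), f (c.x j)⁆)
    (hhh : ∀ i j, f ⁅c.h i, c.h j⁆ = ⁅f (c.h i), f (c.h j)⁆) (u v : 𝔤) :
    f ⁅u, v⁆ = ⁅f u, f v⁆ := by
  refine c.induction (p := fun u => f ⁅u, v⁆ = ⁅f u, f v⁆) (by simp) (fun i => ?_) (fun i => ?_)
    (fun u u' hu hu' => by simp [hu, hu']) (fun a u hu => by simp [hu, map_smulₛₗ]) u
  · refine c.induction (p := fun v => f ⁅c.x i, v⁆ = ⁅f (c.x i), f v⁆) (by simp) (hxx i)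
      (fun j => ?_)
      (fun u u' hu hu' => by simp [hu, hu']) (fun a u hu => by simp [hu, map_smulₛₗ]) v
    rw [← lie_skew, map_neg, hhx, lie_skew]
  · exact c.induction (p := fun v => f ⁅c.h i, v⁆ = ⁅f (c.h i), f v⁆) (by simp) (hhx i) (hhh i)
      (fun u u' hu hu' => by simp [hu, hu']) (fun a u hu => by simp [hu, map_smulₛₗ]) v

/-- An automorphism is determined by its values on the root elements, which generate `𝔤`. -/
theorem autGroup_ext {g g' : 𝔤 ≃ₗ[K] 𝔤} (hg : g ∈ autGroup K 𝔤) (hg' : g' ∈ autGroup K 𝔤)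
    (h : ∀ i, g (c.x i) = g' (c.x i)) : g = g' := by
  apply LinearEquiv.toLinearMap_injective
  refine c.linearMap_ext h fun i => ?_
  change g (c.h i) = g' (c.h i)
  rw [← c.lie_x_neg, hg, hg', h, h]

section CharTwo

variable [Finite ι] [P.IsReduced] [IsSimplyLaced P] [CharP K 2]

theorem add_self (K : Type*) {V : Type*} [Field K] [CharP K 2] [AddCommGroup V] [Module K V]
    (v : V) : v + v = 0 := by
  rw [← two_smul K, CharTwo.two_eq_zero, zero_smul]

theorem neg_eq (K : Type*) {V : Type*} [Field K] [CharP K 2] [AddCommGroup V] [Module K V]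
    (v : V) : -v = v :=
  neg_eq_of_add_eq_zero_left (add_self K v)

theorem lie_x_x_of_neg_one {i j : ι} (h : P.pairingIn ℤ i j = -1) :
    ⁅c.x i, c.x j⁆ = c.x (P.reflectionPerm j i) := by
  rcases c.lie_x_add i j _ (root_add_iff.2 ⟨h, rfl⟩) with h | h
  · exact h
  · rw [h, neg_eq K]

theorem lie_x_x_of_ne {i j : ι} (h : P.pairingIn ℤ i j ≠ -1) (h' : P.pairingIn ℤ i j ≠ -2) :
    ⁅c.x i, c.x j⁆ = 0 := by
  refine c.lie_x_zero i j (fun h0 => h' ?_) ?_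
  · rw [pairingIn_eq_neg_two_iff]
    apply P.root.injective
    rw [root_negIdx]
    exact (neg_eq_of_add_eq_zero_right h0).symm
  · rintro ⟨k, hk⟩
    exact h (root_add_iff.1 hk).1

theorem lie_x_x_of_neg_two {i j : ι} (h : P.pairingIn ℤ i j = -2) : ⁅c.x i, c.x j⁆ = c.h i := by
  rw [pairingIn_eq_neg_two_iff.1 h, c.lie_x_neg]

theorem lie_x_h (i j : ι) : ⁅c.x i, c.h j⁆ = (P.pairingIn ℤ i j : K) • c.x i := by
  rw [← lie_skew, c.lie_h_x, neg_eq K]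

theorem isEvenAdditive_h : IsEvenAdditive P c.h where
  neg i := by
    have := c.lie_x_neg (negIdx P i)
    rw [negIdx_negIdx] at this
    rw [← this, ← lie_skew, c.lie_x_neg, neg_eq K]
  add i j h := c.h_add _ _ _ (coroot_add_iff.2 ⟨h, rfl⟩)

/-- The linear map with given values on the root elements and on the elements `h i`; for the latter
the values have to be even and additive. -/
noncomputable def lift {V : Type*} [AddCommGroup V] [Module K V] (F H : ι → V) : 𝔤 →ₗ[K] V :=
  c.basis.constr K (Sum.elim F fun i => H i)

@[simp] theorem lift_x {V : Type*} [AddCommGroup V] [Module K V] (F H : ι → V) (i : ι) :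
    c.lift F H (c.x i) = F i := by
  rw [← basis_inl, lift, Module.Basis.constr_basis]; rfl

theorem lift_h {V : Type*} [AddCommGroup V] [Module K V] (F : ι → V) {H : ι → V}
    (hH : IsEvenAdditive P H) (i : ι) : c.lift F H (c.h i) = H i := by
  refine IsEvenAdditive.ext b (F := fun i => c.lift F H (c.h i)) ⟨fun i => ?_, fun i j h => ?_⟩ hH
    (fun i hi => ?_) i
  · simp only [c.isEvenAdditive_h.neg]
  · simp only [c.isEvenAdditive_h.add i j h, map_add]
  · change c.lift F H (c.h (⟨i, hi⟩ : b.support)) = H i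
    rw [← basis_inr, lift, Module.Basis.constr_basis]; rfl

open Classical in
/-- The coefficient of the root element `x i`. -/
noncomputable def coeff (i : ι) : 𝔤 →ₗ[K] K := c.lift (fun j => if j = i then 1 else 0) 0

open Classical in
@[simp] theorem coeff_x (i j : ι) : c.coeff i (c.x j) = if j = i then 1 else 0 := c.lift_x _ _ j

@[simp] theorem coeff_h (i j : ι) : c.coeff i (c.h j) = 0 :=
  c.lift_h _ (H := 0) ⟨by simp, by simp⟩ j

/-- The `i`-th root as a linear functional: it vanishes on the root elements. -/
noncomputable def weight (i : ι) : 𝔤 →ₗ[K] K := c.lift 0 fun j => (P.pairingIn ℤ i j : K)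

@[simp] theorem weight_x (i j : ι) : c.weight i (c.x j) = 0 := c.lift_x _ _ j

@[simp] theorem weight_h (i j : ι) : c.weight i (c.h j) = (P.pairingIn ℤ i j : K) :=
  c.lift_h _ (H := fun j => (P.pairingIn ℤ i j : K))
    ⟨fun j => by simp [CharTwo.neg_eq],
     fun j k h => by
      rw [pairingIn_reflectionPerm_right, pairingIn_comm P k j, h]; push_cast; ring⟩ j

/-! ### Monomial automorphisms -/

/-- The linear map `x i ↦ χ i • x (π i)`, `h i ↦ h (π i)`. -/
noncomputable def monoMap (π : Equiv.Perm ι) (χ : ι → Kˣ) : 𝔤 →ₗ[K] 𝔤 :=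
  c.lift (fun i => (χ i : K) • c.x (π i)) (c.h ∘ π)

@[simp] theorem monoMap_x (π : Equiv.Perm ι) (χ : ι → Kˣ) (i : ι) :
    c.monoMap π χ (c.x i) = (χ i : K) • c.x (π i) := c.lift_x _ _ i

theorem monoMap_h {π : Equiv.Perm ι} (hπ : IsRootAut P π) (χ : ι → Kˣ) (i : ι) :
    c.monoMap π χ (c.h i) = c.h (π i) := c.lift_h _ (c.isEvenAdditive_h.comp hπ) i

theorem monoMap_lie {π : Equiv.Perm ι} (hπ : IsRootAut P π) {χ : ι → Kˣ} (hχ : IsChar P χ)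
    (u v : 𝔤) : c.monoMap π χ ⁅u, v⁆ = ⁅c.monoMap π χ u, c.monoMap π χ v⁆ := by
  refine c.map_lie_of_basis _ (fun i j => ?_) (fun i j => ?_) (fun i j => ?_) u v
  · rw [monoMap_x, monoMap_x, smul_lie, lie_smul, smul_smul]
    by_cases h1 : P.pairingIn ℤ i j = -1
    · rw [c.lie_x_x_of_neg_one h1, c.lie_x_x_of_neg_one (by rw [hπ, h1]), monoMap_x, hχ.add _ _ h1,
        hπ.reflectionPerm]
      simp
    by_cases h2 : P.pairingIn ℤ i j = -2
    · rw [c.lie_x_x_of_neg_two h2, c.lie_x_x_of_neg_two (by rw [hπ, h2]), c.monoMap_h hπ,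
        pairingIn_eq_neg_two_iff.1 h2, hχ.neg]
      simp
    · rw [c.lie_x_x_of_ne h1 h2, c.lie_x_x_of_ne (by rwa [hπ]) (by rwa [hπ])]
      simp
  · rw [c.monoMap_h hπ, monoMap_x, c.lie_h_x, lie_smul, c.lie_h_x, map_smul, monoMap_x, hπ,
      smul_comm]
  · rw [c.monoMap_h hπ, c.monoMap_h hπ, c.lie_h_h, c.lie_h_h, map_zero]

theorem monoMap_comp {π ρ : Equiv.Perm ι} (hπ : IsRootAut P π) (hρ : IsRootAut P ρ)
    (χ ψ : ι → Kˣ) : c.monoMap π χ ∘ₗ c.monoMap ρ ψ = c.monoMap (π * ρ) (χ ∘ ρ * ψ) := by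
  refine c.linearMap_ext (fun i => ?_) (fun i => ?_)
  · simp [smul_smul, mul_comm]
  · simp [c.monoMap_h hπ, c.monoMap_h hρ, c.monoMap_h (hπ.mul hρ)]

theorem monoMap_one : c.monoMap 1 1 = LinearMap.id := by
  refine c.linearMap_ext (fun i => ?_) (fun i => ?_)
  · simp
  · simp [c.monoMap_h IsRootAut.one]

/-- The automorphism `x i ↦ χ i • x (π i)` of `𝔤`, where `π` is an automorphism of the root system
and `χ` is a character of the root lattice. -/
noncomputable def mono {π : Equiv.Perm ι} (hπ : IsRootAut P π) {χ : ι → Kˣ} (_hχ : IsChar P χ) :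
    𝔤 ≃ₗ[K] 𝔤 :=
  LinearEquiv.ofLinearMap (c.monoMap π χ) (c.monoMap π⁻¹ (χ⁻¹ ∘ ⇑π⁻¹))
    (by rw [c.monoMap_comp hπ hπ.inv, ← c.monoMap_one]; congr 1 <;> ext <;> simp)
    (by rw [c.monoMap_comp hπ.inv hπ, ← c.monoMap_one]; congr 1 <;> ext <;> simp)

section mono

variable {π : Equiv.Perm ι} (hπ : IsRootAut P π) {χ : ι → Kˣ} (hχ : IsChar P χ)

@[simp] theorem mono_x (i : ι) : c.mono hπ hχ (c.x i) = (χ i : K) • c.x (π i) := c.monoMap_x π χ i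

@[simp] theorem mono_h (i : ι) : c.mono hπ hχ (c.h i) = c.h (π i) := c.monoMap_h hπ χ i

theorem mono_mem_autGroup : c.mono hπ hχ ∈ autGroup K 𝔤 := c.monoMap_lie hπ hχ

end mono

end CharTwo

end ChevalleyBasis

/-- The Weyl group is transitive on the roots: a set of roots that is closed under all reflections
is empty or contains all roots. -/
class IsWeylTransitive {ι M N : Type*} [AddCommGroup M] [Module ℚ M] [AddCommGroup N] [Module ℚ N]
    (P : RootPairing ι ℚ M N) : Prop where
  out : ∀ Q : ι → Prop, (∀ i j, Q i → Q (P.reflectionPerm j i)) → ∀ i, Q i → ∀ j, Q j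

namespace ChevalleyBasis

variable {ι M N : Type*} [AddCommGroup M] [Module ℚ M] [AddCommGroup N] [Module ℚ N]
  {P : RootPairing ι ℚ M N} [P.IsCrystallographic] {b : P.Base}
  {K 𝔤 : Type*} [Field K] [LieRing 𝔤] [LieAlgebra K 𝔤] (c : ChevalleyBasis b K 𝔤)
  [Finite ι] [P.IsReduced] [IsSimplyLaced P] [CharP K 2]

/-- The elements `h i` for simple `i` belong to a basis, and the Weyl group acts on `𝔤`. -/
theorem h_ne_zero (i : ι) : c.h i ≠ 0 := by
  refine b.induction_reflect i (p := fun i => c.h i ≠ 0) (fun i hi => ?_) (fun i hi => ?_)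
    (fun i j hi _ => ?_)
  · exact (c.isEvenAdditive_h.neg i).trans_ne hi
  · simpa using c.basis.ne_zero (Sum.inr ⟨i, hi⟩)
  · rw [← c.mono_h (isRootAut_reflectionPerm P j) (IsChar.one (K := K))]
    exact (LinearEquiv.map_ne_zero_iff _).2 hi

/-! ### The transpositions -/

theorem units_pow_three [hK : Fact (Nat.card K = 4)] (a : Kˣ) : a ^ 3 = 1 := by
  have h : Nat.card Kˣ = 3 := by rw [Nat.card_units, hK.out]
  rw [← h, pow_card_eq_one']

theorem units_sq [Fact (Nat.card K = 4)] (a : Kˣ) : a ^ 2 = a⁻¹ := by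
  rw [eq_inv_iff_mul_eq_one, ← pow_succ, units_pow_three]

/-- The transposition that interchanges `a • x i` and `a⁻¹ • x (-i)`. -/
noncomputable def refl (i : ι) (a : Kˣ) : 𝔤 ≃ₗ[K] 𝔤 :=
  c.mono (isRootAut_reflectionPerm P i) (IsChar.zpow_pairingIn a⁻¹ i)

theorem refl_x (i : ι) (a : Kˣ) (j : ι) :
    c.refl i a (c.x j) = ((a⁻¹ ^ P.pairingIn ℤ j i : Kˣ) : K) • c.x (P.reflectionPerm i j) :=
  c.mono_x _ _ j

theorem refl_mem_autGroup (i : ι) (a : Kˣ) : c.refl i a ∈ autGroup K 𝔤 := c.mono_mem_autGroup _ _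

theorem refl_negIdx (i : ι) (a : Kˣ) : c.refl (negIdx P i) a = c.refl i a⁻¹ := by
  refine c.autGroup_ext (c.refl_mem_autGroup _ _) (c.refl_mem_autGroup _ _) fun j => ?_
  rw [refl_x, refl_x, reflectionPerm_negIdx, pairingIn_negIdx_right, zpow_neg, ← inv_zpow]

/-- The conjugates of a transposition under monomial automorphisms. -/
theorem conj_refl {π : Equiv.Perm ι} (hπ : IsRootAut P π) {χ : ι → Kˣ} (hχ : IsChar P χ) (i : ι)
    (a : Kˣ) {g : 𝔤 ≃ₗ[K] 𝔤} (hg : g ∈ autGroup K 𝔤)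
    (hx : ∀ j, g (c.x j) = (χ j : K) • c.x (π j)) :
    g * c.refl i a * g⁻¹ = c.refl (π i) (χ i * a) := by
  rw [mul_inv_eq_iff_eq_mul]
  refine c.autGroup_ext (mul_mem hg (c.refl_mem_autGroup _ _))
    (mul_mem (c.refl_mem_autGroup _ _) hg) fun j => ?_
  rw [LinearEquiv.mul_apply, LinearEquiv.mul_apply, refl_x, hx, map_smul, map_smul, hx, refl_x,
    smul_smul, smul_smul, hπ, hπ.reflectionPerm, hχ.reflectionPerm]
  congr 1
  norm_cast
  rw [mul_inv_rev, mul_zpow, inv_zpow (χ i), zpow_neg]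
  simp only [inv_zpow, mul_left_comm]

theorem refl_mul_refl_mul_inv (i j : ι) (a d : Kˣ) : c.refl i a * c.refl j d * (c.refl i a)⁻¹ =
    c.refl (P.reflectionPerm i j) (a⁻¹ ^ P.pairingIn ℤ j i * d) :=
  c.conj_refl (isRootAut_reflectionPerm P i) (IsChar.zpow_pairingIn a⁻¹ i) j d
    (c.refl_mem_autGroup _ _) (c.refl_x i a)

theorem refl_mul_self (i : ι) (a : Kˣ) : c.refl i a * c.refl i a = 1 := by
  refine c.autGroup_ext (mul_mem (c.refl_mem_autGroup _ _) (c.refl_mem_autGroup _ _))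
    (one_mem _) fun j => ?_
  rw [LinearEquiv.mul_apply, refl_x, map_smul, refl_x, smul_smul, P.reflectionPerm_self,
    pairingIn_reflectionPerm_left, P.pairingIn_same]
  norm_cast
  rw [← zpow_add]
  ring_nf
  simp

theorem refl_inv (i : ι) (a : Kˣ) : (c.refl i a)⁻¹ = c.refl i a :=
  inv_eq_of_mul_eq_one_left (c.refl_mul_self i a)

section CardFour

variable [Fact (Nat.card K = 4)]

theorem refl_x_self (i : ι) (a : Kˣ) : c.refl i a (c.x i) = (a : K) • c.x (negIdx P i) := by
  rw [refl_x, P.pairingIn_same, reflectionPerm_self_eq, show (2 : ℤ) = (2 : ℕ) from rfl,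
    zpow_natCast, units_sq, inv_inv]

/-- A reflection negates only the roots `±α` that define it. -/
theorem reflectionPerm_eq_neg_iff {i j : ι} :
    P.reflectionPerm i j = negIdx P j ↔ j = i ∨ j = negIdx P i := by
  constructor
  · intro h
    have h1 := pairingIn_reflectionPerm_left P j i j
    rw [h, pairingIn_negIdx_left, P.pairingIn_same, pairingIn_comm P i j] at h1
    rcases pairingIn_mem P j i with h | h | h | h | h <;> rw [h] at h1 <;> norm_num at h1
    · exact Or.inl (pairingIn_eq_two_iff.1 h)
    · rw [pairingIn_comm] at h
      exact Or.inr (pairingIn_eq_neg_two_iff.1 h)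
  · rintro (rfl | rfl)
    · rfl
    · rw [reflectionPerm_apply_negIdx, reflectionPerm_self_eq]

/-- Up to the coincidence `refl (-i) a = refl i a⁻¹`, the transpositions are distinct. -/
theorem refl_eq_refl_iff {i j : ι} {a d : Kˣ} :
    c.refl i a = c.refl j d ↔ (i = j ∧ a = d) ∨ (i = negIdx P j ∧ a = d⁻¹) := by
  constructor
  · intro h
    have inj : ∀ {i : ι} {a d : Kˣ}, c.refl i a = c.refl i d → a = d := by
      intro i a d h
      have := congrArg (fun g => g (c.x i)) h
      simp only [refl_x_self] at this
      exact Units.ext (smul_left_injective K (c.x_ne_zero _) this)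
    have h1 : P.reflectionPerm j i = negIdx P i := by
      have h2 := congrArg (fun g => g (c.x i)) h
      simp only [refl_x_self, refl_x] at h2
      by_contra hne
      have h3 := congrArg (c.coeff (negIdx P i)) h2
      simp [hne] at h3
    rcases reflectionPerm_eq_neg_iff.1 h1 with rfl | rfl
    · exact Or.inl ⟨rfl, inj h⟩
    · rw [refl_negIdx] at h
      exact Or.inr ⟨rfl, by rw [← inj h, inv_inv]⟩
  · rintro (⟨rfl, rfl⟩ | ⟨rfl, rfl⟩)
    · rfl
    · rw [refl_negIdx, inv_inv]

theorem mem_reflections_iff {g : 𝔤 ≃ₗ[K] 𝔤} : g ∈ c.reflections ↔ ∃ i, g = c.refl i 1 := by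
  constructor
  · rintro ⟨hg, i, hi⟩
    exact ⟨i, c.autGroup_ext hg (c.refl_mem_autGroup _ _) fun j => by rw [hi, refl_x]; simp⟩
  · rintro ⟨i, rfl⟩
    exact ⟨c.refl_mem_autGroup _ _, i, fun j => by rw [refl_x]; simp⟩

/-- An element of the torus acts on the root elements by a character of the root lattice. -/
theorem exists_isChar_of_mem_torus {t : 𝔤 ≃ₗ[K] 𝔤} (ht : t ∈ c.torus) :
    ∃ χ : ι → Kˣ, IsChar P χ ∧ ∀ i, t (c.x i) = (χ i : K) • c.x i := by
  obtain ⟨ht, hh, hx⟩ := ht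
  choose f hf using hx
  have h0 : ∀ i, f i ≠ 0 := fun i h => by
    have := hf i
    rw [h, zero_smul] at this
    exact c.x_ne_zero i (t.map_eq_zero_iff.1 this)
  refine ⟨fun i => Units.mk0 (f i) (h0 i), ⟨fun i => ?_, fun i j hij => ?_⟩, hf⟩
  · have := ht (c.x i) (c.x (negIdx P i))
    rw [c.lie_x_neg, hh, hf, hf, smul_lie, lie_smul, c.lie_x_neg, smul_smul] at this
    have h1 : (1 : K) • c.h i = (f i * f (negIdx P i)) • c.h i := by rwa [one_smul]
    have := smul_left_injective K (c.h_ne_zero i) h1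
    rw [eq_inv_iff_mul_eq_one]
    ext
    simp [mul_comm, this]
  · have := ht (c.x i) (c.x j)
    rw [c.lie_x_x_of_neg_one hij, hf, hf, hf, smul_lie, lie_smul, c.lie_x_x_of_neg_one hij,
      smul_smul] at this
    have := smul_left_injective K (c.x_ne_zero _) this
    ext
    simpa using this

theorem mono_one_mem_torus {χ : ι → Kˣ} (hχ : IsChar P χ) : c.mono IsRootAut.one hχ ∈ c.torus :=
  ⟨c.mono_mem_autGroup _ _, fun i => by simp, fun i => ⟨χ i, by simp⟩⟩

theorem refl_one_mem_group (i : ι) : c.refl i 1 ∈ c.group :=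
  Subgroup.subset_closure (Or.inr (c.mem_reflections_iff.2 ⟨i, rfl⟩))

/-- Conjugation by elements of `G` permutes the transpositions `refl i a`. -/
theorem exists_conj_refl_eq {g : 𝔤 ≃ₗ[K] 𝔤} (hg : g ∈ c.group) (i : ι) (a : Kˣ) :
    ∃ j d, g * c.refl i a * g⁻¹ = c.refl j d := by
  suffices h : ∃ π : Equiv.Perm ι, IsRootAut P π ∧ ∃ χ : ι → Kˣ, IsChar P χ ∧
      g ∈ autGroup K 𝔤 ∧ ∀ j, g (c.x j) = (χ j : K) • c.x (π j) by
    obtain ⟨π, hπ, χ, hχ, hg, hx⟩ := h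
    exact ⟨_, _, c.conj_refl hπ hχ i a hg hx⟩
  induction hg using Subgroup.closure_induction with
  | mem g hg =>
    rcases hg with hg | hg
    · obtain ⟨χ, hχ, hx⟩ := c.exists_isChar_of_mem_torus hg
      exact ⟨1, .one, χ, hχ, hg.1, hx⟩
    · obtain ⟨i, rfl⟩ := c.mem_reflections_iff.1 hg
      exact ⟨_, isRootAut_reflectionPerm P i, _, IsChar.zpow_pairingIn 1⁻¹ i,
        c.refl_mem_autGroup _ _, c.refl_x i 1⟩
  | one => exact ⟨1, .one, 1, .one, one_mem _, by simp⟩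
  | mul g g' _ _ hg hg' =>
    obtain ⟨π, hπ, χ, hχ, hg, hx⟩ := hg
    obtain ⟨π', hπ', χ', hχ', hg', hx'⟩ := hg'
    refine ⟨π * π', hπ.mul hπ', χ ∘ π' * χ', (hχ.comp hπ').mul hχ', mul_mem hg hg', fun j => ?_⟩
    rw [LinearEquiv.mul_apply, hx', map_smul, hx, smul_smul]
    simp [mul_comm]
  | inv g _ hg =>
    obtain ⟨π, hπ, χ, hχ, hg, hx⟩ := hg
    refine ⟨π⁻¹, hπ.inv, (χ ∘ ⇑π⁻¹)⁻¹, (hχ.comp hπ.inv).inv, inv_mem hg, fun j => ?_⟩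
    apply g.injective
    rw [← LinearEquiv.mul_apply, mul_inv_cancel, map_smul, hx, smul_smul]
    simp

/-- The elements of `D` are the transpositions `refl i a`: the torus acts transitively on the ones
that belong to a given root. -/
theorem mem_transpositions_iff {d : 𝔤 ≃ₗ[K] 𝔤} :
    d ∈ c.transpositions ↔ ∃ i a, d = c.refl i a := by
  constructor
  · rintro ⟨s, hs, g, hg, rfl⟩
    obtain ⟨i, rfl⟩ := c.mem_reflections_iff.1 hs
    exact c.exists_conj_refl_eq hg i 1
  · rintro ⟨i, a, rfl⟩
    -- The torus element `β ↦ a ^ (2⟨β, α⟩)` takes the value `a ^ 4 = a` at `α`.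
    have hχ : IsChar P fun j => (a ^ 2) ^ P.pairingIn ℤ j i := IsChar.zpow_pairingIn (a ^ 2) i
    refine ⟨c.refl i 1, c.mem_reflections_iff.2 ⟨i, rfl⟩, c.mono IsRootAut.one hχ,
      Subgroup.subset_closure (Or.inl (c.mono_one_mem_torus hχ)), ?_⟩
    rw [c.conj_refl IsRootAut.one hχ i 1 (c.mono_mem_autGroup _ _) (c.mono_x _ _),
      P.pairingIn_same, show (2 : ℤ) = (2 : ℕ) from rfl, zpow_natCast, units_sq, units_sq]
    simp

theorem refl_mem_transpositions (i : ι) (a : Kˣ) : c.refl i a ∈ c.transpositions :=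
  c.mem_transpositions_iff.2 ⟨i, a, rfl⟩

/-- All reflections are conjugate in `G`. -/
theorem exists_conj_refl_one_eq [IsWeylTransitive P] (i j : ι) :
    ∃ g ∈ c.group, g * c.refl i 1 * g⁻¹ = c.refl j 1 := by
  refine IsWeylTransitive.out (P := P) (fun j => ∃ g ∈ c.group, g * c.refl i 1 * g⁻¹ = c.refl j 1)
    (fun j k hj => ?_) i ⟨1, one_mem _, by simp⟩ j
  obtain ⟨g, hg, h⟩ := hj
  refine ⟨c.refl k 1 * g, mul_mem (c.refl_one_mem_group k) hg, ?_⟩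
  have := c.refl_mul_refl_mul_inv k j 1 1
  rw [← h] at this
  simp only [inv_one, one_zpow, mul_one] at this
  rw [← this]
  group

/-- Two transpositions commute or generate a symmetric group of degree `3`. -/
theorem conj_refl_comm {i j : ι} {a d : Kˣ} :
    c.refl i a * c.refl j d * (c.refl i a)⁻¹ = c.refl j d ∨
    c.refl i a * c.refl j d * (c.refl i a)⁻¹ = c.refl j d * c.refl i a * (c.refl j d)⁻¹ := by
  rw [refl_mul_refl_mul_inv, refl_mul_refl_mul_inv]
  rcases pairingIn_mem P j i with h | h | h | h | h
  · left
    rw [reflectionPerm_of_zero h, h]; simp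
  · right
    rw [pairingIn_comm P i j, h, reflectionPerm_of_one h, refl_negIdx]
    simp [mul_comm]
  · right
    rw [pairingIn_comm P i j, h, reflectionPerm_comm_of_neg_one h]
    simp [mul_comm]
  · right
    obtain rfl := pairingIn_eq_two_iff.1 h
    rw [h, reflectionPerm_self_eq, show (2 : ℤ) = (2 : ℕ) from rfl, zpow_natCast, zpow_natCast,
      units_sq, units_sq, inv_inv, inv_inv, mul_comm]
  · right
    obtain rfl := pairingIn_eq_neg_two_iff.1 h
    rw [pairingIn_comm P (negIdx P j) j, h, reflectionPerm_negIdx, reflectionPerm_self_eq,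
      reflectionPerm_apply_negIdx, reflectionPerm_self_eq, negIdx_negIdx, refl_negIdx,
      show (-2 : ℤ) = -(2 : ℕ) from rfl, zpow_neg, zpow_neg, zpow_natCast, zpow_natCast, units_sq,
      units_sq]
    simp [mul_comm]

theorem isClass [IsWeylTransitive P] [Nonempty ι] : IsClass c.group c.transpositions where
  conj_class := by
    obtain ⟨i⟩ := ‹Nonempty ι›
    refine ⟨c.refl i 1, c.refl_one_mem_group i, Set.ext fun d => ⟨?_, ?_⟩⟩
    · rintro ⟨s, hs, g, hg, rfl⟩
      obtain ⟨j, rfl⟩ := c.mem_reflections_iff.1 hs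
      obtain ⟨g', hg', h⟩ := c.exists_conj_refl_one_eq i j
      exact ⟨g * g', mul_mem hg hg', by rw [← h]; group⟩
    · rintro ⟨g, hg, rfl⟩
      exact ⟨_, c.mem_reflections_iff.2 ⟨i, rfl⟩, g, hg, rfl⟩
  order_eq_two d hd := by
    obtain ⟨i, a, rfl⟩ := c.mem_transpositions_iff.1 hd
    rw [orderOf_eq_prime_iff]
    refine ⟨by rw [pow_two, refl_mul_self], fun h => ?_⟩
    have h1 := congrArg (fun g => c.coeff (negIdx P i) (g (c.x i))) h
    have h2 : i ≠ negIdx P i := fun h => by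
      have := pairingIn_eq_neg_two_iff.2 h
      rw [P.pairingIn_same] at this
      norm_num at this
    simp [refl_x_self, h2] at h1
  order_mul d hd e he := by
    obtain ⟨i, a, rfl⟩ := c.mem_transpositions_iff.1 hd
    obtain ⟨j, a', rfl⟩ := c.mem_transpositions_iff.1 he
    set d := c.refl i a with hd'
    set e := c.refl j a' with he'
    have hd2 : d * d = 1 := c.refl_mul_self i a
    have he2 : e * e = 1 := c.refl_mul_self j a'
    have hdi : d⁻¹ = d := c.refl_inv i a
    have hei : e⁻¹ = e := c.refl_inv j a'
    have h := c.conj_refl_comm (i := i) (j := j) (a := a) (d := a')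
    rw [← hd', ← he', hdi, hei] at h
    rcases h with h | h
    · have : (d * e) ^ 2 = 1 := by
        rw [pow_two, ← mul_assoc, h, he2]
      rcases (Nat.dvd_prime Nat.prime_two).1 (orderOf_dvd_of_pow_eq_one this) with h | h <;>
      simp [h]
    · have : (d * e) ^ 3 = 1 := by
        have : (d * e) ^ 3 = (d * e * d) * (e * d * e) := by
          simp only [pow_succ, pow_zero, one_mul, mul_assoc]
        rw [this, ← h]
        simp only [mul_assoc]
        rw [← mul_assoc d d, hd2, one_mul, ← mul_assoc e e, he2, one_mul, hd2]
      rcases (Nat.dvd_prime Nat.prime_three).1 (orderOf_dvd_of_pow_eq_one this) with h | h <;>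
      simp [h]

end CardFour

end ChevalleyBasis

namespace ChevalleyBasis

variable {ι M N : Type*} [AddCommGroup M] [Module ℚ M] [AddCommGroup N] [Module ℚ N]
  {P : RootPairing ι ℚ M N} [P.IsCrystallographic] {b : P.Base}
  {K 𝔤 : Type*} [Field K] [LieRing 𝔤] [LieAlgebra K 𝔤] (c : ChevalleyBasis b K 𝔤)
  [Finite ι] [P.IsReduced] [IsSimplyLaced P] [CharP K 2] [Fact (Nat.card K = 4)]

/-! ### The field with four elements -/

theorem one_add_unit_add_inv {a : Kˣ} (ha : a ≠ 1) : (1 : K) + a + (a⁻¹ : Kˣ) = 0 := by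
  have h1 : (a : K) - 1 ≠ 0 := sub_ne_zero.2 (by simpa using ha)
  have h2 : (a : K) ^ 3 = 1 := by
    rw [← Units.val_pow_eq_pow_val, units_pow_three, Units.val_one]
  rw [← units_sq]
  apply mul_left_cancel₀ h1
  push_cast
  linear_combination h2

variable (K) in
theorem exists_unit_ne_one : ∃ a : Kˣ, a ≠ 1 := by
  by_contra! h
  have : Subsingleton Kˣ := ⟨fun a d => by rw [h a, h d]⟩
  have h1 : Nat.card Kˣ = 1 := Nat.card_of_subsingleton 1
  rw [Nat.card_units, (Fact.out : Nat.card K = 4)] at h1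
  norm_num at h1

theorem unit_add_unit_add {a d : Kˣ} (h : a ≠ d) : (a : K) + d + ((a * d)⁻¹ : Kˣ) = 0 := by
  have h1 : a * d⁻¹ ≠ 1 := fun h1 => h (mul_inv_eq_one.1 h1)
  have h2 := one_add_unit_add_inv h1
  have h3 := congrArg (fun z => (d : K) * z) h2
  have h4 : d * (a * d⁻¹)⁻¹ = (a * d)⁻¹ := by
    rw [mul_inv_rev, inv_inv, ← mul_assoc, ← pow_two, units_sq]; simp [mul_comm]
  rw [← h4]
  push_cast
  simp only [mul_add, mul_zero] at h3
  rw [← h3]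
  push_cast
  field_simp
  ring

/-! ### The root elements `x(α, ω)` -/

theorem rootElement_unit (i : ι) (a : Kˣ) : c.rootElement i (a : K) =
    (a : K) • c.x i + ((a⁻¹ : Kˣ) : K) • c.x (negIdx P i) + c.h i := by
  have h1 : (a : K) ^ 2 = ((a⁻¹ : Kˣ) : K) := by rw [← units_sq]; simp
  rw [rootElement, h1, c.lie_x_neg, Units.mul_inv, one_smul]

theorem rootElement_zero (i : ι) : c.rootElement i (0 : K) = 0 := by
  simp [rootElement]

theorem rootElement_negIdx (i : ι) (a : Kˣ) :
    c.rootElement (negIdx P i) (a : K) = c.rootElement i ((a⁻¹ : Kˣ) : K) := by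
  rw [rootElement_unit, rootElement_unit, negIdx_negIdx, c.isEvenAdditive_h.neg, inv_inv,
    add_comm (_ • _)]

theorem sum_rootElement (i : ι) {a d : Kˣ} (h : a ≠ d) : c.rootElement i (a : K) +
    c.rootElement i (d : K) + c.rootElement i (((a * d)⁻¹ : Kˣ) : K) = c.h i := by
  have h1 := unit_add_unit_add h
  have h2 : a⁻¹ ≠ d⁻¹ := fun h' => h (inv_injective h')
  have h3 := unit_add_unit_add h2
  rw [← mul_inv] at h3
  rw [rootElement_unit, rootElement_unit, rootElement_unit]
  have h4 : c.h i + c.h i = 0 := add_self K _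
  linear_combination (norm := module) h1 • c.x i + h3 • c.x (negIdx P i) + h4

/-- The elements `x(α, ω)` of two commuting points of `D` commute. -/
theorem rootElement_lie_zero {i j : ι} (h : P.pairingIn ℤ i j = 0) (a d : Kˣ) :
    ⁅c.rootElement i (a : K), c.rootElement j (d : K)⁆ = 0 := by
  have h' : P.pairingIn ℤ j i = 0 := by rw [pairingIn_comm, h]
  simp [rootElement_unit, c.lie_x_h, c.lie_h_x, c.lie_h_h, lie_x_x_of_ne, h, h']

/-- The bracket of the elements `x(α, ω)` of two points on a line of `D`, with different roots. -/
theorem rootElement_lie_neg_one {i j : ι} (h : P.pairingIn ℤ i j = -1) (a d : Kˣ) :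
    ⁅c.rootElement i (a : K), c.rootElement j (d : K)⁆ =
      c.rootElement i (a : K) + c.rootElement j (d : K) +
        c.rootElement (P.reflectionPerm j i) ((a * d : Kˣ) : K) := by
  have h' : P.pairingIn ℤ j i = -1 := by rw [pairingIn_comm, h]
  have e1 := c.lie_x_x_of_neg_one h
  have e2 : ⁅c.x (negIdx P i), c.x (negIdx P j)⁆ = c.x (negIdx P (P.reflectionPerm j i)) := by
    rw [c.lie_x_x_of_neg_one (by simp [h]), reflectionPerm_negIdx, reflectionPerm_apply_negIdx]
  have e3 : ⁅c.x i, c.x (negIdx P j)⁆ = 0 := c.lie_x_x_of_ne (by simp [h]) (by simp [h])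
  have e4 : ⁅c.x (negIdx P i), c.x j⁆ = 0 := c.lie_x_x_of_ne (by simp [h]) (by simp [h])
  simp only [rootElement_unit, add_lie, lie_add, smul_lie, lie_smul, e1, e2, e3, e4, c.lie_x_h,
    c.lie_h_x, c.lie_h_h, pairingIn_negIdx_left, h, h',
    c.isEvenAdditive_h.add i j h]
  have hi : c.h i + c.h i = 0 := add_self K _
  have hj : c.h j + c.h j = 0 := add_self K _
  have h2 : (-1 : K) = 1 := CharTwo.neg_eq 1
  simp only [neg_neg, Int.cast_neg, Int.cast_one, h2, mul_inv, Units.val_mul]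
  linear_combination (norm := module) -hi - hj

/-- The bracket of the elements `x(α, ω)` of two points on a line of `D`, with equal roots; by
`sum_rootElement`, this is the sum of the three elements of the line. -/
theorem rootElement_lie_self (i : ι) {a d : Kˣ} (h : a ≠ d) :
    ⁅c.rootElement i (a : K), c.rootElement i (d : K)⁆ = c.h i := by
  have e1 : ⁅c.x (negIdx P i), c.x i⁆ = c.h i := by
    rw [c.lie_x_x_of_neg_two (by simp), c.isEvenAdditive_h.neg]
  have h1 : a * d⁻¹ ≠ 1 := fun h1 => h (mul_inv_eq_one.1 h1)
  have h2 := one_add_unit_add_inv h1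
  simp only [rootElement_unit, add_lie, lie_add, smul_lie, lie_smul, e1, c.lie_x_neg, c.lie_x_h,
    c.lie_h_x, c.lie_h_h, pairingIn_negIdx_left, P.pairingIn_same, lie_self]
  have h3 : (2 : K) = 0 := CharTwo.two_eq_zero
  push_cast
  rw [h3]
  simp only [neg_zero, zero_smul, smul_zero, zero_add, add_zero, smul_smul, ← add_smul]
  rw [mul_inv, inv_inv, Units.val_mul, Units.val_mul] at h2
  have h4 : (d : K) * (a : K)⁻¹ + (d : K)⁻¹ * a = 1 := by
    push_cast at h2
    linear_combination h2 - h3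
  rw [h4, one_smul]

/-- A subspace over `K` that contains all elements `x(α, ω)` is all of `𝔤`. -/
theorem eq_top_of_rootElement_mem {S : Submodule K 𝔤}
    (h : ∀ i (a : Kˣ), c.rootElement i (a : K) ∈ S) : S = ⊤ := by
  obtain ⟨a, ha⟩ := exists_unit_ne_one K
  have hh : ∀ i, c.h i ∈ S := fun i => by
    rw [← c.sum_rootElement i ha]
    exact add_mem (add_mem (h _ _) (h _ _)) (h _ _)
  refine (Submodule.eq_top_iff').2 (c.induction (p := fun v => v ∈ S) (zero_mem _) (fun i => ?_) hh
    (fun _ _ => add_mem) fun a _ => S.smul_mem a)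
  have h1 := S.smul_mem ((a⁻¹ : Kˣ) : K) (sub_mem (h i 1) (hh i))
  have h2 := add_mem h1 (sub_mem (h i a) (hh i))
  have h3 := one_add_unit_add_inv ha
  rw [rootElement_unit, rootElement_unit] at h2
  convert h2 using 1
  simp only [inv_one, Units.val_one]
  have h4 : ((a⁻¹ : Kˣ) : K) + a = 1 := by
    have h2 : (2 : K) = 0 := CharTwo.two_eq_zero
    linear_combination h3 - h2
  have h5 : ((a⁻¹ : Kˣ) : K) + (a⁻¹ : Kˣ) = 0 := CharTwo.add_self_eq_zero _
  linear_combination (norm := module) -h4 • c.x i - h5 • c.x (negIdx P i)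

/-! ### The homomorphism from `A(D)` to `𝔤₂` -/

/-- The transposition `refl i a` as a point of `D`. -/
noncomputable def pt (i : ι) (a : Kˣ) : c.transpositions :=
  ⟨c.refl i a, c.refl_mem_transpositions i a⟩

theorem exists_eq_pt (d : c.transpositions) : ∃ i a, d = c.pt i a := by
  obtain ⟨i, a, h⟩ := c.mem_transpositions_iff.1 d.2
  exact ⟨i, a, Subtype.ext h⟩

theorem pt_negIdx (i : ι) (a : Kˣ) : c.pt (negIdx P i) a = c.pt i a⁻¹ :=
  Subtype.ext (c.refl_negIdx i a)

/-- The element `x(α, ω)` of `𝔤` that belongs to a point of `D`. -/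
noncomputable def pointElement (d : c.transpositions) : 𝔤 :=
  c.rootElement (c.exists_eq_pt d).choose ((c.exists_eq_pt d).choose_spec.choose : K)

theorem rootElement_eq_of_pt_eq {i j : ι} {a d : Kˣ} (h : c.pt i a = c.pt j d) :
    c.rootElement i (a : K) = c.rootElement j (d : K) := by
  rcases c.refl_eq_refl_iff.1 (congrArg Subtype.val h) with ⟨rfl, rfl⟩ | ⟨rfl, rfl⟩
  · rfl
  · rw [rootElement_negIdx, inv_inv]

@[simp] theorem pointElement_pt (i : ι) (a : Kˣ) :
    c.pointElement (c.pt i a) = c.rootElement i (a : K) :=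
  (c.rootElement_eq_of_pt_eq (c.exists_eq_pt (c.pt i a)).choose_spec.choose_spec).symm

/-- Any two points of `D` can be written with roots that are orthogonal, have product `-1`, or are
equal, since the signs of the roots can be chosen. -/
theorem exists_pair (d e : c.transpositions) : ∃ i j a a', d = c.pt i a ∧ e = c.pt j a' ∧
    (P.pairingIn ℤ i j = 0 ∨ P.pairingIn ℤ i j = -1 ∨ i = j ∧ a ≠ a' ∨ i = j ∧ a = a') := by
  obtain ⟨i, a, rfl⟩ := c.exists_eq_pt d
  obtain ⟨j, a', rfl⟩ := c.exists_eq_pt e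
  rcases pairingIn_mem P i j with h | h | h | h | h
  · exact ⟨i, j, a, a', rfl, rfl, Or.inl h⟩
  · exact ⟨i, negIdx P j, a, a'⁻¹, rfl, by rw [pt_negIdx, inv_inv],
      Or.inr (Or.inl (by simp [h]))⟩
  · exact ⟨i, j, a, a', rfl, rfl, Or.inr (Or.inl h)⟩
  · have := pairingIn_eq_two_iff.1 h
    exact ⟨i, j, a, a', rfl, rfl, by tauto⟩
  · have := pairingIn_eq_neg_two_iff.1 h
    refine ⟨i, negIdx P j, a, a'⁻¹, rfl, by rw [pt_negIdx, inv_inv], ?_⟩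
    rw [this, negIdx_negIdx]
    tauto

theorem commute_pt_of_zero {i j : ι} (h : P.pairingIn ℤ i j = 0) (a d : Kˣ) :
    Commute (c.pt i a : 𝔤 ≃ₗ[K] 𝔤) (c.pt j d) := by
  have h1 := c.refl_mul_refl_mul_inv i j a d
  rw [pairingIn_comm] at h
  rw [reflectionPerm_of_zero h, h, zpow_zero, one_mul, mul_inv_eq_iff_eq_mul] at h1
  exact h1

theorem isLine_of_conj_eq {i j k : ι} {a d z : Kˣ}
    (h : c.refl i a * c.refl j d * (c.refl i a)⁻¹ = c.refl k z) (hne : c.refl k z ≠ c.refl j d) :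
    IsLine c.transpositions (c.pt i a) (c.pt j d) (c.pt k z) := by
  refine ⟨fun hc => hne ?_, ?_, ?_⟩
  · rw [← h, mul_inv_eq_iff_eq_mul]
    exact hc
  · change c.refl k z = (c.refl j d)⁻¹ * c.refl i a * c.refl j d
    rcases c.conj_refl_comm (i := i) (j := j) (a := a) (d := d) with h' | h'
    · exact absurd (h.symm.trans h') hne
    · rw [h] at h'
      rw [h', refl_inv]
  · change c.refl k z = (c.refl i a)⁻¹ * c.refl j d * c.refl i a
    rw [← h, refl_inv]

theorem isLine_of_neg_one {i j : ι} (h : P.pairingIn ℤ i j = -1) (a d : Kˣ) :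
    IsLine c.transpositions (c.pt i a) (c.pt j d) (c.pt (P.reflectionPerm j i) (a * d)) := by
  refine c.isLine_of_conj_eq ?_ fun h' => ?_
  · rw [refl_mul_refl_mul_inv, reflectionPerm_comm_of_neg_one h, pairingIn_comm, h]
    simp
  · have h1 := pairingIn_reflectionPerm_left P i j j
    rw [h, P.pairingIn_same] at h1
    rcases c.refl_eq_refl_iff.1 h' with ⟨h2, -⟩ | ⟨h2, -⟩ <;> rw [h2] at h1 <;>
    simp at h1

theorem isLine_of_ne (i : ι) {a d : Kˣ} (h : a ≠ d) :
    IsLine c.transpositions (c.pt i a) (c.pt i d) (c.pt i (a * d)⁻¹) := by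
  refine c.isLine_of_conj_eq ?_ fun h' => ?_
  · rw [refl_mul_refl_mul_inv, reflectionPerm_self_eq, refl_negIdx, P.pairingIn_same,
      show (2 : ℤ) = (2 : ℕ) from rfl, zpow_natCast, units_sq, inv_inv]
  · have h3 : (a * d)⁻¹ = d := by
      have := congrArg (fun g => g (c.x i)) h'
      simp only [refl_x_self] at this
      exact Units.ext (smul_left_injective K (c.x_ne_zero _) this)
    rw [inv_eq_iff_mul_eq_one, mul_assoc, ← pow_two, units_sq] at h3
    exact h (mul_inv_eq_one.1 h3)

theorem pointMul_of_commute {d e : c.transpositions} (h : Commute (d : 𝔤 ≃ₗ[K] 𝔤) e) :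
    pointMul c.transpositions d e = 0 := by
  rw [pointMul, dif_neg]
  rintro ⟨f, hf⟩
  exact hf.1 h

section Forms

variable [Algebra (ZMod 2) K] [LieAlgebra (ZMod 2) 𝔤] [IsScalarTower (ZMod 2) K 𝔤]

/-- The linear map from `A(D)` to `𝔤` that maps the points of `D` to the elements `x(α, ω)`. -/
noncomputable def algMap : Alg c.transpositions →ₗ[ZMod 2] 𝔤 :=
  Finsupp.linearCombination (ZMod 2) c.pointElement

@[simp] theorem algMap_single (d : c.transpositions) :
    c.algMap (Finsupp.single d 1) = c.pointElement d := by
  simp [algMap]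

theorem algMap_pointMul (d e : c.transpositions) :
    c.algMap (pointMul c.transpositions d e) = ⁅c.pointElement d, c.pointElement e⁆ := by
  obtain ⟨i, j, a, a', rfl, rfl, h | h | ⟨rfl, h⟩ | ⟨rfl, rfl⟩⟩ := c.exists_pair d e
  · rw [c.pointMul_of_commute (c.commute_pt_of_zero h a a')]
    simp [c.rootElement_lie_zero h]
  · rw [pointMul_of_isLine _ (c.isLine_of_neg_one h a a')]
    simp only [map_add, algMap_single, pointElement_pt, c.rootElement_lie_neg_one h]
  · rw [pointMul_of_isLine _ (c.isLine_of_ne i h)]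
    simp only [map_add, algMap_single, pointElement_pt, c.rootElement_lie_self i h,
      c.sum_rootElement i h]
  · rw [c.pointMul_of_commute (Commute.refl _)]
    simp

/-- The map `A(D) → 𝔤` is a homomorphism: it is one on the points of `D`, for which the cases of a
common root, of orthogonal roots and of non-orthogonal roots are checked. -/
theorem algMap_mul (Y Z : Alg c.transpositions) :
    c.algMap (mul c.transpositions Y Z) = ⁅c.algMap Y, c.algMap Z⁆ := by
  induction Y using Finsupp.induction_linear with
  | zero => simp
  | add Y Y' h h' => simp only [map_add, LinearMap.add_apply, add_lie, h, h']
  | single d r =>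
    induction Z using Finsupp.induction_linear with
    | zero => simp
    | add Z Z' h h' => simp only [map_add, lie_add, h, h']
    | single e s =>
      rw [← mul_one r, ← mul_one s, ← smul_eq_mul, ← smul_eq_mul, ← Finsupp.smul_single,
        ← Finsupp.smul_single]
      simp only [map_smul, LinearMap.smul_apply, smul_lie, lie_smul, mul_single, algMap_pointMul,
        algMap_single]

/-- The elements `x(α, ω)` span `𝔤₂`, since their span is closed under the bracket. -/
theorem range_algMap : LinearMap.range c.algMap = c.gTwo.toSubmodule := by
  apply le_antisymm
  · rintro _ ⟨Y, rfl⟩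
    induction Y using Finsupp.induction_linear with
    | zero => simp
    | add Y Y' h h' => rw [map_add]; exact add_mem h h'
    | single d r =>
      rw [← mul_one r, ← smul_eq_mul, ← Finsupp.smul_single, map_smul, algMap_single]
      exact Submodule.smul_mem _ _ (LieSubalgebra.subset_lieSpan ⟨_, _, rfl⟩)
  · let S : LieSubalgebra (ZMod 2) 𝔤 :=
      { LinearMap.range c.algMap with
        lie_mem' := by
          rintro _ _ ⟨Y, rfl⟩ ⟨Z, rfl⟩
          exact ⟨mul c.transpositions Y Z, c.algMap_mul Y Z⟩ }
    change c.gTwo ≤ S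
    refine LieSubalgebra.lieSpan_le.2 ?_
    rintro _ ⟨i, ω, rfl⟩
    by_cases hω : ω = 0
    · rw [hω, rootElement_zero]; exact S.zero_mem
    · exact ⟨Finsupp.single (c.pt i (Units.mk0 ω hω)) 1, by simp⟩

/-- The pairing with `x(α, a)` under the invariant bilinear form of `𝔤` for which `x i` and `x (-i)`
are dual to each other. -/
noncomputable def pairing (i : ι) (a : Kˣ) : 𝔤 →ₗ[K] K :=
  (a : K) • c.coeff (negIdx P i) + ((a⁻¹ : Kˣ) : K) • c.coeff i + c.weight i

theorem negIdx_ne (i : ι) : negIdx P i ≠ i := fun h => by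
  have := pairingIn_eq_neg_two_iff.2 h.symm
  rw [P.pairingIn_same] at this
  norm_num at this

theorem pairing_negIdx (i : ι) (a : Kˣ) : c.pairing (negIdx P i) a = c.pairing i a⁻¹ := by
  have : c.weight (negIdx P i) = c.weight i :=
    c.linearMap_ext (by simp) (by simp [CharTwo.neg_eq])
  rw [pairing, pairing, negIdx_negIdx, this, inv_inv, add_comm (_ • _)]

theorem pairing_eq_of_pt_eq {i j : ι} {a d : Kˣ} (h : c.pt i a = c.pt j d) :
    c.pairing i a = c.pairing j d := by
  rcases c.refl_eq_refl_iff.1 (congrArg Subtype.val h) with ⟨rfl, rfl⟩ | ⟨rfl, rfl⟩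
  · rfl
  · rw [pairing_negIdx, inv_inv]

theorem negIdx_eq_iff {i j : ι} : negIdx P i = j ↔ i = negIdx P j :=
  ⟨fun h => by rw [← h, negIdx_negIdx], fun h => by rw [h, negIdx_negIdx]⟩

open Classical in
/-- The pairing of the elements `x(α, ω)` is the form on the points of `D`. -/
theorem pairing_rootElement (i j : ι) (a d : Kˣ) :
    c.pairing j d (c.rootElement i (a : K)) =
      if Commute (c.pt i a : 𝔤 ≃ₗ[K] 𝔤) (c.pt j d) then 0 else 1 := by
  obtain ⟨i', j', a', d', h1, h2, h⟩ := c.exists_pair (c.pt i a) (c.pt j d)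
  rw [c.rootElement_eq_of_pt_eq h1, c.pairing_eq_of_pt_eq h2, h1, h2]
  clear h1 h2
  have key : c.pairing j' d' (c.rootElement i' (a' : K)) =
      (if i' = negIdx P j' then (d' * a' + (d'⁻¹ : Kˣ) * (a'⁻¹ : Kˣ) : K) else 0) +
      (if i' = j' then (d' * (a'⁻¹ : Kˣ) + (d'⁻¹ : Kˣ) * a' : K) else 0) +
      (P.pairingIn ℤ i' j' : K) := by
    rw [pairing, rootElement_unit, pairingIn_comm P i' j']
    simp only [LinearMap.add_apply, LinearMap.smul_apply, map_add, map_smul, coeff_x, coeff_h,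
      weight_x, weight_h, negIdx_eq_iff, negIdx_negIdx, smul_eq_mul]
    split_ifs <;> ring
  rw [key]
  rcases h with h | h | ⟨rfl, h⟩ | ⟨rfl, rfl⟩
  · have h1 : i' ≠ j' := fun h' => by rw [pairingIn_eq_two_iff.2 h'] at h; norm_num at h
    have h2 : i' ≠ negIdx P j' := fun h' => by
      rw [pairingIn_eq_neg_two_iff.2 (negIdx_eq_iff.2 h').symm] at h; norm_num at h
    rw [if_neg h1, if_neg h2, h, if_pos (c.commute_pt_of_zero h _ _)]
    simp
  · have h1 : i' ≠ j' := fun h' => by rw [pairingIn_eq_two_iff.2 h'] at h; norm_num at h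
    have h2 : i' ≠ negIdx P j' := fun h' => by
      rw [pairingIn_eq_neg_two_iff.2 (negIdx_eq_iff.2 h').symm] at h; norm_num at h
    rw [if_neg h1, if_neg h2, h, if_neg (c.isLine_of_neg_one h _ _).1]
    simp [CharTwo.neg_eq]
  · rw [if_neg (negIdx_ne i').symm, if_pos rfl, P.pairingIn_same, if_neg (c.isLine_of_ne i' h).1]
    have h1 := one_add_unit_add_inv (a := d' * a'⁻¹)
      fun h1 => h (mul_inv_eq_one.1 h1).symm
    rw [mul_inv, inv_inv] at h1
    have h3 : (2 : K) = 0 := CharTwo.two_eq_zero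
    push_cast at h1 ⊢
    linear_combination h1
  · rw [if_neg (negIdx_ne i').symm, if_pos rfl, P.pairingIn_same, if_pos (Commute.refl _)]
    have h3 : (2 : K) = 0 := CharTwo.two_eq_zero
    rw [Units.mul_inv, Units.inv_mul]
    push_cast
    linear_combination 2 * h3

/-- The form on `A(D)` is the pullback of the invariant form of `𝔤`. -/
theorem algebraMap_form (Y : Alg c.transpositions) (j : ι) (d : Kˣ) :
    algebraMap (ZMod 2) K (form c.transpositions Y (Finsupp.single (c.pt j d) 1)) =
      c.pairing j d (c.algMap Y) := by
  induction Y using Finsupp.induction_linear with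
  | zero => simp
  | add Y Y' h h' => simp only [map_add, LinearMap.add_apply, h, h']
  | single e r =>
    obtain ⟨i, a, rfl⟩ := c.exists_eq_pt e
    rw [← mul_one r, ← smul_eq_mul, ← Finsupp.smul_single]
    simp only [map_smul, LinearMap.smul_apply, form_single, algMap_single, pointElement_pt]
    rw [← algebraMap_smul K r (c.rootElement i (a : K)), (c.pairing j d).map_smul,
      pairing_rootElement, Algebra.smul_def, smul_eq_mul]
    split_ifs <;> simp

theorem mem_vanishing_iff (Y : Alg c.transpositions) : Y ∈ vanishing c.transpositions ↔
    ∀ i a, c.pairing i a (c.algMap Y) = 0 := by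
  rw [vanishing, LinearMap.mem_ker]
  constructor
  · intro h i a
    rw [← algebraMap_form, h, LinearMap.zero_apply, map_zero]
  · intro h
    refine LinearMap.ext fun Z => ?_
    induction Z using Finsupp.induction_linear with
    | zero => simp
    | add Z Z' h h' => rw [map_add, h, h', map_add]
    | single e r =>
      obtain ⟨i, a, rfl⟩ := c.exists_eq_pt e
      rw [← mul_one r, ← smul_eq_mul, ← Finsupp.smul_single, map_smul]
      have := c.algebraMap_form Y i a
      rw [h, map_eq_zero] at this
      rw [this]; simp

/-! ### The centre of `𝔤` -/

/-- The three pairings with `x(i, a)`, for `a ∈ K^*`, determine the values of the functionals `coeff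
i`, `coeff (-i)` and `weight i`. -/
theorem pairing_eq_zero_iff (z : 𝔤) :
    (∀ i a, c.pairing i a z = 0) ↔ ∀ i, c.coeff i z = 0 ∧ c.weight i z = 0 := by
  constructor
  · intro h i
    obtain ⟨a, ha⟩ := exists_unit_ne_one K
    have h1 := h i 1
    have h2 := h i a
    have h3 := h i a⁻¹
    have ha' := one_add_unit_add_inv ha
    have h4 : (2 : K) = 0 := CharTwo.two_eq_zero
    simp only [pairing, LinearMap.add_apply, LinearMap.smul_apply, smul_eq_mul, inv_inv, inv_one,
      Units.val_one, one_mul] at h1 h2 h3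
    have hw : c.weight i z = 0 := by
      linear_combination h1 + h2 + h3 - (c.coeff i z + c.coeff (negIdx P i) z) * ha' -
        c.weight i z * h4
    refine ⟨?_, hw⟩
    rw [hw] at h1 h2
    linear_combination -((a : K) * h1 - h2) + c.coeff i z * ha' -
      c.coeff i z * ((a⁻¹ : Kˣ) : K) * h4
  · intro h i a
    simp [pairing, (h i).1, (h i).2, (h (negIdx P i)).1]

/-- The projection of `𝔤` onto the Cartan subalgebra. -/
noncomputable def cartanPart : 𝔤 →ₗ[K] 𝔤 := c.lift 0 c.h

@[simp] theorem cartanPart_x (i : ι) : c.cartanPart (c.x i) = 0 := c.lift_x _ _ i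

@[simp] theorem cartanPart_h (i : ι) : c.cartanPart (c.h i) = c.h i :=
  c.lift_h _ c.isEvenAdditive_h i

theorem sum_coeff_add_cartanPart [Fintype ι] (z : 𝔤) :
    ∑ i, c.coeff i z • c.x i + c.cartanPart z = z := by
  refine c.induction (p := fun z => ∑ i, c.coeff i z • c.x i + c.cartanPart z = z) (by simp)
    (fun i => ?_) (fun i => by simp) (fun u v hu hv => ?_) (fun a v hv => ?_) z
  · rw [Finset.sum_eq_single i] <;> simp +contextual [eq_comm]
  · conv_rhs => rw [← hu, ← hv]
    simp only [map_add, add_smul, Finset.sum_add_distrib]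
    abel
  · conv_rhs => rw [← hv]
    simp only [map_smul, smul_add, Finset.smul_sum, smul_smul, smul_eq_mul]

theorem cartanPart_lie_x (z : 𝔤) (i : ι) : ⁅c.cartanPart z, c.x i⁆ = c.weight i z • c.x i :=
  c.induction (p := fun z => ⁅c.cartanPart z, c.x i⁆ = c.weight i z • c.x i) (by simp)
    (fun j => by simp) (fun j => by simp [c.lie_h_x])
    (fun u v hu hv => by simp [add_smul, hu, hv]) (fun a v hv => by simp [hv, smul_smul]) z

theorem cartanPart_lie_h (z : 𝔤) (i : ι) : ⁅c.cartanPart z, c.h i⁆ = 0 :=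
  c.induction (p := fun z => ⁅c.cartanPart z, c.h i⁆ = 0) (by simp)
    (fun j => by simp) (fun j => by simp [c.lie_h_h])
    (fun u v hu hv => by simp [hu, hv]) (fun a v hv => by simp [hv]) z

theorem cartanPart_lie_negIdx (z : 𝔤) (i : ι) :
    c.cartanPart ⁅z, c.x (negIdx P i)⁆ = c.coeff i z • c.h i := by
  refine c.induction
    (p := fun z => c.cartanPart ⁅z, c.x (negIdx P i)⁆ = c.coeff i z • c.h i) (by simp)
    (fun j => ?_) (fun j => by simp [c.lie_h_x]) (fun u v hu hv => by simp [add_smul, hu, hv])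
    (fun a v hv => by simp [hv, smul_smul]) z
  by_cases hj : j = i
  · subst hj; simp [c.lie_x_neg]
  · have h1 : P.pairingIn ℤ j (negIdx P i) ≠ -2 := fun h => hj <| by
      rw [← negIdx_negIdx P i, pairingIn_eq_neg_two_iff.1 h, negIdx_negIdx]
    by_cases h2 : P.pairingIn ℤ j (negIdx P i) = -1
    · rw [c.lie_x_x_of_neg_one h2]; simp [hj]
    · rw [c.lie_x_x_of_ne h2 h1]; simp [hj]

theorem coeff_lie_x (z : 𝔤) (i : ι) : c.coeff i ⁅z, c.x i⁆ = c.weight i z := by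
  refine c.induction (p := fun z => c.coeff i ⁅z, c.x i⁆ = c.weight i z) (by simp)
    (fun j => ?_) (fun j => by simp [c.lie_h_x]) (fun u v hu hv => by simp [hu, hv])
    (fun a v hv => by simp [hv]) z
  rw [weight_x]
  by_cases h1 : P.pairingIn ℤ j i = -2
  · rw [c.lie_x_x_of_neg_two h1, coeff_h]
  by_cases h2 : P.pairingIn ℤ j i = -1
  · rw [c.lie_x_x_of_neg_one h2, coeff_x, if_neg]
    intro h3
    have h4 := pairingIn_reflectionPerm_left P j i i
    rw [h3, P.pairingIn_same, h2] at h4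
    norm_num at h4
  · rw [c.lie_x_x_of_ne h2 h1, map_zero]

/-- The centre of `𝔤` consists of the elements of the Cartan subalgebra on which all roots
vanish. -/
theorem forall_lie_eq_zero_iff (z : 𝔤) :
    (∀ y : 𝔤, ⁅z, y⁆ = 0) ↔ ∀ i, c.coeff i z = 0 ∧ c.weight i z = 0 := by
  constructor
  · intro h i
    have h1 := c.cartanPart_lie_negIdx z i
    rw [h, map_zero, eq_comm, smul_eq_zero] at h1
    exact ⟨h1.resolve_right (c.h_ne_zero i), by rw [← coeff_lie_x, h, map_zero]⟩
  · intro h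
    have := Fintype.ofFinite ι
    have hz := c.sum_coeff_add_cartanPart z
    simp only [(h _).1, zero_smul, Finset.sum_const_zero, zero_add] at hz
    refine c.induction (by simp) (fun i => ?_) (fun i => ?_) (fun u v hu hv => by simp [hu, hv])
      (fun a v hv => by simp [hv])
    · rw [← hz, cartanPart_lie_x, (h i).2, zero_smul]
    · rw [← hz, cartanPart_lie_h]

/-- The centre of `𝔤₂` is its intersection with the centre of `𝔤`, since `𝔤₂` spans `𝔤` over `K`. -/
theorem mem_center_gTwo_iff (z : c.gTwo) : z ∈ LieAlgebra.center (ZMod 2) c.gTwo ↔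
    ∀ y : 𝔤, ⁅(z : 𝔤), y⁆ = 0 := by
  rw [LieModule.mem_maxTrivSubmodule]
  constructor
  · intro h y
    let S : Submodule K 𝔤 := LinearMap.ker (LieAlgebra.ad K 𝔤 (z : 𝔤))
    have hS : S = ⊤ := c.eq_top_of_rootElement_mem fun i a => by
      have h1 : c.rootElement i (a : K) ∈ c.gTwo := LieSubalgebra.subset_lieSpan ⟨i, a, rfl⟩
      have h2 := congrArg Subtype.val (h ⟨_, h1⟩)
      rw [LinearMap.mem_ker, LieAlgebra.ad_apply, ← lie_skew, neg_eq_zero]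
      exact h2
    have : y ∈ S := hS ▸ Submodule.mem_top
    simpa [S] using this
  · intro h y
    apply Subtype.ext
    rw [LieSubalgebra.coe_bracket, ← lie_skew, h]
    simp

theorem algMap_mem_gTwo (Y : Alg c.transpositions) : c.algMap Y ∈ c.gTwo := by
  change c.algMap Y ∈ c.gTwo.toSubmodule
  rw [← c.range_algMap]
  exact ⟨Y, rfl⟩

/-- The radical of the form on `A(D)` is the preimage of the centre of `𝔤₂`. -/
theorem algMap_mem_center_iff (Y : Alg c.transpositions) :
    (⟨c.algMap Y, c.algMap_mem_gTwo Y⟩ : c.gTwo) ∈ LieAlgebra.center (ZMod 2) c.gTwo ↔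
      Y ∈ vanishing c.transpositions := by
  rw [c.mem_center_gTwo_iff, c.forall_lie_eq_zero_iff, c.mem_vanishing_iff, c.pairing_eq_zero_iff]

/-- The isomorphism of `A(D) / V(D)` and `𝔤₂ / Z(𝔤₂)` that is induced by `algMap`. -/
theorem exists_quotient_equiv : ∃ φ : (Alg c.transpositions ⧸ vanishing c.transpositions) ≃ₗ[ZMod 2]
      (c.gTwo ⧸ LieAlgebra.center (ZMod 2) c.gTwo),
    ∀ Y Z : Alg c.transpositions,
      φ (Submodule.Quotient.mk (mul c.transpositions Y Z)) =
        ⁅φ (Submodule.Quotient.mk Y), φ (Submodule.Quotient.mk Z)⁆ := by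
  let Φ : Alg c.transpositions →ₗ[ZMod 2] c.gTwo :=
    c.algMap.codRestrict c.gTwo.toSubmodule c.algMap_mem_gTwo
  let Ψ : Alg c.transpositions →ₗ[ZMod 2] c.gTwo ⧸ LieAlgebra.center (ZMod 2) c.gTwo :=
    (LieAlgebra.center (ZMod 2) c.gTwo).toSubmodule.mkQ ∘ₗ Φ
  have hker : vanishing c.transpositions = LinearMap.ker Ψ := by
    ext Y
    rw [← algMap_mem_center_iff, LinearMap.mem_ker]
    exact (Submodule.Quotient.mk_eq_zero _).symm
  have hsurj : Function.Surjective Ψ := by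
    refine (Submodule.mkQ_surjective _).comp fun z => ?_
    have hz : (z : 𝔤) ∈ LinearMap.range c.algMap := by rw [c.range_algMap]; exact z.2
    obtain ⟨Y, hY⟩ := hz
    exact ⟨Y, Subtype.ext hY⟩
  refine ⟨(Submodule.quotEquivOfEq _ _ hker).trans (Ψ.quotKerEquivOfSurjective hsurj),
    fun Y Z => ?_⟩
  change Ψ (mul c.transpositions Y Z) = ⁅Ψ Y, Ψ Z⁆
  have h1 : Φ (mul c.transpositions Y Z) = ⁅Φ Y, Φ Z⁆ := Subtype.ext (c.algMap_mul Y Z)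
  change LieSubmodule.Quotient.mk (Φ (mul c.transpositions Y Z)) = _
  rw [h1]
  rfl

end Forms

end ChevalleyBasis

namespace ChevalleyBasis

variable {ι M N : Type*} [AddCommGroup M] [Module ℚ M] [AddCommGroup N] [Module ℚ N]
  {P : RootPairing ι ℚ M N} [P.IsCrystallographic] {b : P.Base}
  {K 𝔤 : Type*} [Field K] [LieRing 𝔤] [LieAlgebra K 𝔤] (c : ChevalleyBasis b K 𝔤)
  [Finite ι] [P.IsReduced] [IsSimplyLaced P] [CharP K 2]

/-! ### Root groups -/

/-- The square of `ad (x i)` takes `x (-i)` to a multiple of `2 x i`, so it is `0`. -/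
theorem lie_x_lie_x (i : ι) (z : 𝔤) : ⁅c.x i, ⁅c.x i, z⁆⁆ = 0 := by
  refine c.induction (p := fun z => ⁅c.x i, ⁅c.x i, z⁆⁆ = 0) (by simp) (fun j => ?_)
    (fun j => by simp [c.lie_x_h]) (fun u v hu hv => by simp [hu, hv])
    (fun a v hv => by simp [hv]) z
  by_cases h1 : P.pairingIn ℤ i j = -2
  · rw [c.lie_x_x_of_neg_two h1, c.lie_x_h, P.pairingIn_same]
    simp [CharTwo.two_eq_zero]
  by_cases h2 : P.pairingIn ℤ i j = -1
  · have h3 : P.pairingIn ℤ i (P.reflectionPerm j i) = 1 := by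
      rw [pairingIn_reflectionPerm_right, P.pairingIn_same, pairingIn_comm P j i, h2]; norm_num
    rw [c.lie_x_x_of_neg_one h2, c.lie_x_x_of_ne] <;> rw [h3] <;> norm_num
  · rw [c.lie_x_x_of_ne h2 h1, lie_zero]

theorem lie_lie_x (i : ι) (z : 𝔤) : ⁅⁅c.x i, z⁆, c.x i⁆ = 0 := by
  rw [← lie_skew, lie_x_lie_x, neg_zero]

theorem coeff_negIdx_lie (i : ι) (z : 𝔤) : c.coeff (negIdx P i) ⁅c.x i, z⁆ = 0 := by
  refine c.induction (p := fun z => c.coeff (negIdx P i) ⁅c.x i, z⁆ = 0) (by simp) (fun j => ?_)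
    (fun j => by simp [c.lie_x_h, (negIdx_ne i).symm]) (fun u v hu hv => by simp [hu, hv])
    (fun a v hv => by simp [hv]) z
  by_cases h1 : P.pairingIn ℤ i j = -2
  · rw [c.lie_x_x_of_neg_two h1, coeff_h]
  by_cases h2 : P.pairingIn ℤ i j = -1
  · rw [c.lie_x_x_of_neg_one h2, coeff_x, if_neg]
    intro h
    have h3 := pairingIn_reflectionPerm_right P i j i
    rw [h, pairingIn_comm P j i, h2, pairingIn_negIdx_right, P.pairingIn_same] at h3
    norm_num at h3
  · rw [c.lie_x_x_of_ne h2 h1, map_zero]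

/-- In characteristic `2`, half the square of `ad (x i)` is the map `q : z ↦ coeff (-i) z • x i`.
This is the Leibniz rule for it. -/
theorem coeff_lie_smul_x (i : ι) (y z : 𝔤) : c.coeff (negIdx P i) ⁅y, z⁆ • c.x i =
    c.coeff (negIdx P i) y • ⁅c.x i, z⁆ + c.coeff (negIdx P i) z • ⁅c.x i, y⁆ +
      ⁅⁅c.x i, y⁆, ⁅c.x i, z⁆⁆ := by
  set T : 𝔤 → 𝔤 → Prop := fun y z => c.coeff (negIdx P i) ⁅y, z⁆ • c.x i =
    c.coeff (negIdx P i) y • ⁅c.x i, z⁆ + c.coeff (negIdx P i) z • ⁅c.x i, y⁆ +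
      ⁅⁅c.x i, y⁆, ⁅c.x i, z⁆⁆ with hT
  have hsymm : ∀ {y z}, T y z → T z y := by
    intro y z h
    simp only [hT] at h ⊢
    rw [← lie_skew, neg_eq K, h, ← lie_skew _ ⁅c.x i, z⁆, neg_eq K, add_comm (_ • _)]
  have hxh : ∀ j k, T (c.x j) (c.h k) := by
    intro j k
    simp only [hT, c.lie_x_h, coeff_h, zero_smul, add_zero, lie_smul, lie_lie_x, smul_zero,
      map_smul, coeff_x, smul_eq_mul]
    split_ifs with h
    · rw [h, pairingIn_negIdx_left]; simp [neg_eq K]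
    · simp
  have hnx : ∀ k, T (c.x (negIdx P i)) (c.x k) := by
    intro k
    have hneg : ⁅c.x i, c.x (negIdx P i)⁆ = c.h i := c.lie_x_neg i
    simp only [hT, hneg, coeff_x, if_true, one_smul]
    by_cases h2 : P.pairingIn ℤ i k = -2
    · rw [pairingIn_eq_neg_two_iff.1 h2]
      simp [c.lie_x_neg, add_self K]
    have hk : k ≠ negIdx P i := fun h => h2 (pairingIn_eq_neg_two_iff.2 h)
    rw [if_neg hk, zero_smul, add_zero]
    by_cases h1 : P.pairingIn ℤ i k = -1
    · have h3 : P.pairingIn ℤ (P.reflectionPerm k i) i = 1 := by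
        rw [pairingIn_reflectionPerm_left, P.pairingIn_same, pairingIn_comm P k i, h1]; norm_num
      rw [c.lie_x_x_of_ne (i := negIdx P i) (by simp [h1]) (by simp [h1]), map_zero, zero_smul,
        c.lie_x_x_of_neg_one h1, c.lie_h_x, h3, Int.cast_one, one_smul, add_self K]
    · rw [c.lie_x_x_of_ne h1 h2, lie_zero, add_zero]
      suffices h : c.coeff (negIdx P i) ⁅c.x (negIdx P i), c.x k⁆ = 0 by rw [h, zero_smul]
      by_cases h3 : P.pairingIn ℤ i k = 1
      · rw [c.lie_x_x_of_neg_one (by simp [h3]), coeff_x, if_neg]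
        intro h
        have h4 := pairingIn_reflectionPerm_left P (negIdx P i) k i
        rw [h, pairingIn_comm P k i, h3] at h4
        simp [h3] at h4
      by_cases h4 : P.pairingIn ℤ i k = 2
      · rw [c.lie_x_x_of_neg_two (by simp [h4]), coeff_h]
      · rw [c.lie_x_x_of_ne (by rw [pairingIn_negIdx_left]; omega)
          (by rw [pairingIn_negIdx_left]; omega), map_zero]
  have hxx : ∀ j k, T (c.x j) (c.x k) := by
    intro j k
    by_cases hj : j = negIdx P i
    · rw [hj]; exact hnx k
    by_cases hk : k = negIdx P i
    · rw [hk]; exact hsymm (hnx j)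
    simp only [hT, coeff_x, if_neg hj, if_neg hk, zero_smul, zero_add]
    have hj2 : P.pairingIn ℤ i j ≠ -2 := fun h => hj (pairingIn_eq_neg_two_iff.1 h)
    have hk2 : P.pairingIn ℤ i k ≠ -2 := fun h => hk (pairingIn_eq_neg_two_iff.1 h)
    -- The left side is nonzero only if the roots `j` and `k` have sum `-i`.
    have hl : ¬ (P.pairingIn ℤ i j = -1 ∧ P.pairingIn ℤ i k = -1 ∧ P.pairingIn ℤ j k = -1) →
        c.coeff (negIdx P i) ⁅c.x j, c.x k⁆ = 0 := by
      intro h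
      by_cases h2 : P.pairingIn ℤ j k = -2
      · rw [c.lie_x_x_of_neg_two h2, coeff_h]
      by_cases h1 : P.pairingIn ℤ j k = -1
      · rw [c.lie_x_x_of_neg_one h1, coeff_x, if_neg]
        intro h3
        have h4 := pairingIn_reflectionPerm_left P j k j
        have h5 := pairingIn_reflectionPerm_left P j k k
        rw [h3, pairingIn_negIdx_left, P.pairingIn_same, pairingIn_comm P k j, h1] at h4
        rw [h3, pairingIn_negIdx_left, P.pairingIn_same, h1] at h5
        omega
      · rw [c.lie_x_x_of_ne h1 h2, map_zero]
    by_cases h : P.pairingIn ℤ i j = -1 ∧ P.pairingIn ℤ i k = -1 ∧ P.pairingIn ℤ j k = -1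
    · obtain ⟨h1, h2, h3⟩ := h
      have e1 : P.pairingIn ℤ (P.reflectionPerm j i) (P.reflectionPerm k i) = -1 := by
        simp only [pairingIn_reflectionPerm_left, pairingIn_reflectionPerm_right,
          P.pairingIn_same, pairingIn_comm P k i, pairingIn_comm P j i, h1, h2, h3]
        norm_num
      rw [c.lie_x_x_of_neg_one h1, c.lie_x_x_of_neg_one h2, c.lie_x_x_of_neg_one e1,
        c.lie_x_x_of_neg_one h3, coeff_x, if_pos, one_smul]
      · congr 1
        rw [← pairingIn_eq_two_iff (P := P)]
        simp only [pairingIn_reflectionPerm_left, pairingIn_reflectionPerm_right,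
          P.pairingIn_same, pairingIn_comm P k i, pairingIn_comm P j i, pairingIn_comm P k j, h1,
          h2, h3]
        norm_num
      · rw [← pairingIn_eq_two_iff (P := P)]
        simp only [pairingIn_reflectionPerm_left, pairingIn_negIdx_right, pairingIn_comm P k i,
          pairingIn_comm P j i, h1, h2, h3]
        norm_num
    · rw [hl h, zero_smul]
      by_cases h1 : P.pairingIn ℤ i j = -1
      · by_cases h2 : P.pairingIn ℤ i k = -1
        · have h3 : P.pairingIn ℤ j k ≠ -1 := fun h3 => h ⟨h1, h2, h3⟩
          have h4 : P.pairingIn ℤ j k ≠ -2 := fun h4 => by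
            rw [pairingIn_eq_neg_two_iff.1 h4, pairingIn_negIdx_right] at h2
            omega
          have e1 : P.pairingIn ℤ (P.reflectionPerm j i) (P.reflectionPerm k i) =
              P.pairingIn ℤ j k := by
            simp only [pairingIn_reflectionPerm_left, pairingIn_reflectionPerm_right,
              P.pairingIn_same, pairingIn_comm P k i, pairingIn_comm P j i, h1, h2]
            ring
          rw [c.lie_x_x_of_neg_one h1, c.lie_x_x_of_neg_one h2,
            c.lie_x_x_of_ne (by rwa [e1]) (by rwa [e1])]
        · rw [c.lie_x_x_of_ne h2 hk2, lie_zero]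
      · rw [c.lie_x_x_of_ne h1 hj2, zero_lie]
  refine c.induction (p := fun y => T y z) (by simp [hT]) (fun j => ?_) (fun j => ?_)
    (fun u v hu hv => ?_) (fun a v hv => ?_) y
  · refine c.induction (p := fun z => T (c.x j) z) (by simp [hT]) (hxx j) (hxh j)
      (fun u v hu hv => ?_) (fun a v hv => ?_) z
    · simp only [hT, map_add, lie_add, add_smul, smul_add] at hu hv ⊢
      rw [hu, hv]; abel
    · simp only [hT, map_smul, lie_smul, smul_eq_mul, mul_smul] at hv ⊢
      rw [hv]; module
  · refine c.induction (p := fun z => T (c.h j) z) (by simp [hT]) (fun k => hsymm (hxh k j))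
      (fun k => ?_) (fun u v hu hv => ?_) (fun a v hv => ?_) z
    · simp [hT, c.lie_h_h, c.lie_x_h, c.lie_h_x]
    · simp only [hT, map_add, lie_add, add_smul, smul_add] at hu hv ⊢
      rw [hu, hv]; abel
    · simp only [hT, map_smul, lie_smul, smul_eq_mul, mul_smul] at hv ⊢
      rw [hv]; module
  · simp only [hT, map_add, add_lie, lie_add, add_smul, smul_add] at hu hv ⊢
    rw [hu, hv]; abel
  · simp only [hT, map_smul, smul_lie, lie_smul, smul_eq_mul, mul_smul] at hv ⊢
    rw [hv]; module

/-- The root automorphism `exp (t ad (x i))`, with `coeff (-i) z • x i` for half the square of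
`ad (x i)`. -/
noncomputable def rootMap (i : ι) (t : K) : 𝔤 →ₗ[K] 𝔤 :=
  LinearMap.id + t • LieAlgebra.ad K 𝔤 (c.x i) +
    t ^ 2 • (c.coeff (negIdx P i)).smulRight (c.x i)

theorem rootMap_apply (i : ι) (t : K) (z : 𝔤) :
    c.rootMap i t z = z + t • ⁅c.x i, z⁆ + (t ^ 2 * c.coeff (negIdx P i) z) • c.x i := by
  simp [rootMap, mul_smul]

theorem rootMap_rootMap (i : ι) (s t : K) (z : 𝔤) :
    c.rootMap i s (c.rootMap i t z) = c.rootMap i (s + t) z := by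
  simp only [rootMap_apply, lie_x_lie_x, lie_self, map_add, map_smul, coeff_negIdx_lie, coeff_x,
    if_neg (negIdx_ne i).symm, smul_zero, add_zero, mul_zero, CharTwo.add_sq]
  module

theorem rootMap_zero (i : ι) (z : 𝔤) : c.rootMap i 0 z = z := by
  simp [rootMap_apply]

theorem rootMap_lie (i : ι) (t : K) (y z : 𝔤) :
    c.rootMap i t ⁅y, z⁆ = ⁅c.rootMap i t y, c.rootMap i t z⁆ := by
  have h := c.coeff_lie_smul_x i y z
  simp only [rootMap_apply, lie_add, add_lie, lie_smul, smul_lie, lie_self, lie_lie_x,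
    lie_x_lie_x, smul_zero, add_zero, leibniz_lie (c.x i) y z]
  rw [mul_smul, h]
  have h1 : ⁅y, c.x i⁆ = ⁅c.x i, y⁆ := by rw [← lie_skew, neg_eq K]
  rw [h1]
  module

/-- The root automorphisms as invertible linear maps. -/
noncomputable def rootAut (i : ι) (t : K) : 𝔤 ≃ₗ[K] 𝔤 :=
  LinearEquiv.ofInvolutive (c.rootMap i t) fun z => by
    rw [rootMap_rootMap, CharTwo.add_self_eq_zero, rootMap_zero]

@[simp] theorem rootAut_apply (i : ι) (t : K) (z : 𝔤) : c.rootAut i t z = c.rootMap i t z := rfl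

theorem rootAut_mem_autGroup (i : ι) (t : K) : c.rootAut i t ∈ autGroup K 𝔤 := c.rootMap_lie i t

end ChevalleyBasis

namespace ChevalleyBasis

variable {ι M N : Type*} [AddCommGroup M] [Module ℚ M] [AddCommGroup N] [Module ℚ N]
  {P : RootPairing ι ℚ M N} [P.IsCrystallographic] {b : P.Base}
  {K 𝔤 : Type*} [Field K] [LieRing 𝔤] [LieAlgebra K 𝔤] (c : ChevalleyBasis b K 𝔤)
  [Finite ι] [P.IsReduced] [IsSimplyLaced P] [CharP K 2]

theorem refl_negIdx_one (i : ι) : c.refl (negIdx P i) 1 = c.refl i 1 := by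
  rw [refl_negIdx, inv_one]

theorem refl_one_x (i j : ι) : c.refl i 1 (c.x j) = c.x (P.reflectionPerm i j) := by
  rw [refl_x]; simp

theorem rootMap_x_self (i : ι) (t : K) : c.rootMap i t (c.x i) = c.x i := by
  simp [rootMap_apply, (negIdx_ne i).symm]

theorem rootMap_x_negIdx (i : ι) (t : K) :
    c.rootMap i t (c.x (negIdx P i)) = c.x (negIdx P i) + t • c.h i + t ^ 2 • c.x i := by
  simp [rootMap_apply, c.lie_x_neg]

theorem rootMap_h_self (i : ι) (t : K) : c.rootMap i t (c.h i) = c.h i := by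
  simp [rootMap_apply, c.lie_x_h, CharTwo.two_eq_zero]

theorem rootMap_x_of_neg_one {i j : ι} (h : P.pairingIn ℤ i j = -1) (t : K) :
    c.rootMap i t (c.x j) = c.x j + t • c.x (P.reflectionPerm i j) := by
  have hj : j ≠ negIdx P i := fun h' => by
    rw [pairingIn_eq_neg_two_iff.2 h'] at h; norm_num at h
  simp [rootMap_apply, c.lie_x_x_of_neg_one h, hj, reflectionPerm_comm_of_neg_one h]

theorem rootMap_x_of_nonneg {i j : ι} (h : 0 ≤ P.pairingIn ℤ i j) (t : K) :
    c.rootMap i t (c.x j) = c.x j := by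
  have hj : j ≠ negIdx P i := fun h' => by
    rw [pairingIn_eq_neg_two_iff.2 h'] at h; norm_num at h
  simp [rootMap_apply, c.lie_x_x_of_ne (i := i) (j := j) (by omega) (by omega), hj]

/-- A reflection is the usual product of three root automorphisms. -/
theorem refl_one_eq (i : ι) :
    c.refl i 1 = c.rootAut i 1 * c.rootAut (negIdx P i) 1 * c.rootAut i 1 := by
  refine c.autGroup_ext (c.refl_mem_autGroup _ _) (mul_mem (mul_mem (c.rootAut_mem_autGroup _ _)
    (c.rootAut_mem_autGroup _ _)) (c.rootAut_mem_autGroup _ _)) fun j => ?_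
  rw [refl_one_x, LinearEquiv.mul_apply, LinearEquiv.mul_apply]
  simp only [rootAut_apply]
  have e1 : c.rootMap (negIdx P i) 1 (c.x i) = c.x i + c.h i + c.x (negIdx P i) := by
    have := c.rootMap_x_negIdx (negIdx P i) 1
    simpa [c.isEvenAdditive_h.neg] using this
  have e2 : c.rootMap (negIdx P i) 1 (c.h i) = c.h i := by
    simpa [c.isEvenAdditive_h.neg] using c.rootMap_h_self (negIdx P i) 1
  rcases pairingIn_mem P i j with h | h | h | h | h
  · rw [c.rootMap_x_of_nonneg h.ge, c.rootMap_x_of_nonneg (i := negIdx P i) (by simp [h]),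
      c.rootMap_x_of_nonneg h.ge, reflectionPerm_of_zero (by rw [pairingIn_comm, h])]
  · have h1 : P.pairingIn ℤ i (P.reflectionPerm i j) = -1 := by
      rw [pairingIn_reflectionPerm_right, P.pairingIn_same, h]; norm_num
    rw [c.rootMap_x_of_nonneg (by omega), c.rootMap_x_of_neg_one (by simp [h]), map_add, map_smul,
      c.rootMap_x_of_nonneg (by omega), reflectionPerm_negIdx, c.rootMap_x_of_neg_one h1,
      P.reflectionPerm_self]
    linear_combination (norm := module) -add_self K (c.x j)
  · have h1 : P.pairingIn ℤ i (P.reflectionPerm i j) = 1 := by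
      rw [pairingIn_reflectionPerm_right, P.pairingIn_same, h]; norm_num
    rw [c.rootMap_x_of_neg_one h, map_add, map_smul, c.rootMap_x_of_nonneg (by simp [h]),
      c.rootMap_x_of_neg_one (by simp [h1]), reflectionPerm_negIdx, P.reflectionPerm_self]
    simp only [map_add, map_smul, c.rootMap_x_of_neg_one h,
      c.rootMap_x_of_nonneg (i := i) (j := P.reflectionPerm i j) (by omega)]
    linear_combination (norm := module)
      -add_self K (c.x j) - add_self K (c.x (P.reflectionPerm i j))
  · obtain rfl := pairingIn_eq_two_iff.1 h
    rw [rootMap_x_self, e1, map_add, map_add, rootMap_x_self, rootMap_h_self, rootMap_x_negIdx,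
      reflectionPerm_self_eq]
    linear_combination (norm := module) -add_self K (c.x i) - add_self K (c.h i)
  · obtain rfl := pairingIn_eq_neg_two_iff.1 h
    rw [rootMap_x_negIdx, reflectionPerm_apply_negIdx, reflectionPerm_self_eq, negIdx_negIdx]
    simp only [LinearMap.map_add (c.rootMap (negIdx P i) 1),
      LinearMap.map_smul (c.rootMap (negIdx P i) 1), e1, e2, rootMap_x_self]
    have e3 : c.x (negIdx P i) + (1 : K) • c.h i +
        (1 : K) ^ 2 • (c.x i + c.h i + c.x (negIdx P i)) = c.x i := by
      linear_combination (norm := module) add_self K (c.x (negIdx P i)) + add_self K (c.h i)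
    rw [e3, rootMap_x_self]

/-- Root automorphisms are compatible with semilinear bracket-preserving maps. -/
theorem map_rootMap {θ : K →+* K} (F : 𝔤 →ₛₗ[θ] 𝔤) (hF : ∀ u v, F ⁅u, v⁆ = ⁅F u, F v⁆) {i k : ι}
    (hx : F (c.x i) = c.x k)
    (hc : ∀ z, c.coeff (negIdx P k) (F z) = θ (c.coeff (negIdx P i) z)) (t : K) (z : 𝔤) :
    F (c.rootMap i t z) = c.rootMap k (θ t) (F z) := by
  simp only [rootMap_apply, map_add, map_smulₛₗ, hF, hx, hc, map_mul, map_pow]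

/-! ### Twisted Frobenius maps -/

/-- The Frobenius map with respect to the Chevalley basis. -/
noncomputable def frob : 𝔤 →ₛₗ[frobenius K 2] 𝔤 where
  toFun z := c.basis.repr.symm
    ((c.basis.repr z).mapRange (frobenius K 2) (map_zero (frobenius K 2)))
  map_add' u v := by
    rw [map_add, Finsupp.mapRange_add (fun a d => map_add (frobenius K 2) a d), map_add]
  map_smul' a v := by
    rw [← c.basis.repr.symm.map_smul]
    congr 1
    ext k
    simp [mul_pow, frobenius_def]

theorem repr_frob (z : 𝔤) (k : ι ⊕ b.support) :
    c.basis.repr (c.frob z) k = c.basis.repr z k ^ 2 := by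
  change c.basis.repr (c.basis.repr.symm _) _ = _
  rw [LinearEquiv.apply_symm_apply, Finsupp.mapRange_apply, frobenius_def]

theorem frob_basis (k : ι ⊕ b.support) : c.frob (c.basis k) = c.basis k := by
  change c.basis.repr.symm _ = _
  rw [c.basis.repr_self, Finsupp.mapRange_single, map_one, ← c.basis.repr_self,
    LinearEquiv.symm_apply_apply]

@[simp] theorem frob_x (i : ι) : c.frob (c.x i) = c.x i := by
  rw [← basis_inl, frob_basis]

@[simp] theorem frob_h (i : ι) : c.frob (c.h i) = c.h i := by
  refine IsEvenAdditive.ext b (F := fun i => c.frob (c.h i)) ⟨fun i => ?_, fun i j h => ?_⟩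
    c.isEvenAdditive_h (fun i hi => ?_) i
  · simp only [c.isEvenAdditive_h.neg]
  · simp only [c.isEvenAdditive_h.add i j h, map_add]
  · have := c.frob_basis (Sum.inr ⟨i, hi⟩)
    simpa using this

/-- The semilinear map `x i ↦ x (π i)`. -/
noncomputable def twistMap (π : Equiv.Perm ι) : 𝔤 →ₛₗ[frobenius K 2] 𝔤 :=
  (c.monoMap π 1).comp c.frob

@[simp] theorem twistMap_x (π : Equiv.Perm ι) (i : ι) : c.twistMap π (c.x i) = c.x (π i) := by
  simp [twistMap]

section Twist

variable {π : Equiv.Perm ι} (hπ : IsRootAut P π)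
include hπ

theorem twistMap_h (i : ι) : c.twistMap π (c.h i) = c.h (π i) := by
  simp [twistMap, c.monoMap_h hπ]

theorem twistMap_lie (u v : 𝔤) : c.twistMap π ⁅u, v⁆ = ⁅c.twistMap π u, c.twistMap π v⁆ := by
  refine c.map_lie_of_basis _ (fun i j => ?_) (fun i j => ?_) (fun i j => ?_) u v
  · simp only [twistMap_x]
    by_cases h1 : P.pairingIn ℤ i j = -1
    · rw [c.lie_x_x_of_neg_one h1, c.lie_x_x_of_neg_one (by rw [hπ, h1]), twistMap_x,
        hπ.reflectionPerm]
    by_cases h2 : P.pairingIn ℤ i j = -2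
    · rw [c.lie_x_x_of_neg_two h2, c.lie_x_x_of_neg_two (by rw [hπ, h2]), c.twistMap_h hπ]
    · rw [c.lie_x_x_of_ne h1 h2, c.lie_x_x_of_ne (by rwa [hπ]) (by rwa [hπ]), map_zero]
  · rw [c.twistMap_h hπ, twistMap_x, c.lie_h_x, c.lie_h_x, map_smulₛₗ, twistMap_x, hπ, map_intCast]
  · rw [c.twistMap_h hπ, c.twistMap_h hπ, c.lie_h_h, c.lie_h_h, map_zero]

theorem coeff_twistMap (i : ι) (z : 𝔤) :
    c.coeff (π i) (c.twistMap π z) = frobenius K 2 (c.coeff i z) := by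
  refine c.induction (p := fun z => c.coeff (π i) (c.twistMap π z) = frobenius K 2 (c.coeff i z))
    (by simp) (fun j => ?_) (fun j => by simp [c.twistMap_h hπ]) (fun u v hu hv => by simp [hu, hv])
    (fun a v hv => by simp [hv, map_smulₛₗ]) z
  by_cases h : j = i
  · simp [h]
  · simp [h, π.injective.ne h]

theorem twistMap_rootMap (i : ι) (t : K) (z : 𝔤) :
    c.twistMap π (c.rootMap i t z) = c.rootMap (π i) (t ^ 2) (c.twistMap π z) :=
  c.map_rootMap (c.twistMap π) (c.twistMap_lie hπ) (c.twistMap_x π i)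
    (fun z => by rw [← hπ.negIdx, c.coeff_twistMap hπ]) t z

theorem refl_twistMap (i : ι) (z : 𝔤) :
    c.refl i 1 (c.twistMap π z) = c.twistMap (P.reflectionPerm i * π) z := by
  have hs := (isRootAut_reflectionPerm P i).mul hπ
  refine c.induction
    (p := fun z => c.refl i 1 (c.twistMap π z) = c.twistMap (P.reflectionPerm i * π) z)
    (by simp) (fun j => by simp [refl_one_x]) (fun j => ?_) (fun u v hu hv => by simp [hu, hv])
    (fun a v hv => by simp [hv, map_smulₛₗ]) z
  rw [c.twistMap_h hπ, c.twistMap_h hs]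
  exact c.mono_h _ _ _

/-- The Frobenius map of the field with four elements is an involution. -/
theorem twistMap_inv_apply [Fact (Nat.card K = 4)] (z : 𝔤) :
    c.twistMap π⁻¹ (c.twistMap π z) = z := by
  refine c.induction (p := fun z => c.twistMap π⁻¹ (c.twistMap π z) = z)
    (by simp) (fun j => by simp) (fun j => ?_) (fun u v hu hv => by simp [hu, hv])
    (fun a v hv => ?_) z
  · rw [c.twistMap_h hπ, c.twistMap_h hπ.inv]; simp
  · rw [map_smulₛₗ, map_smulₛₗ, hv]
    congr 1
    by_cases ha : a = 0
    · simp [ha]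
    · have h1 := units_sq (Units.mk0 a ha)
      have h2 := units_sq (Units.mk0 a ha)⁻¹
      have h3 := congrArg Units.val (h1 ▸ h2 : (Units.mk0 a ha ^ 2) ^ 2 = (Units.mk0 a ha)⁻¹⁻¹)
      simpa [frobenius_def] using h3

end Twist

theorem rootMap_refl_one (i : ι) (t : K) (z : 𝔤) :
    c.refl i 1 (c.rootMap i t z) = c.rootMap (negIdx P i) t (c.refl i 1 z) := by
  refine c.map_rootMap (θ := RingHom.id K) (c.refl i 1 : 𝔤 →ₗ[K] 𝔤) (c.refl_mem_autGroup i 1)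
    (c.refl_one_x i i) (fun z => ?_) t z
  rw [reflectionPerm_self_eq, negIdx_negIdx]
  refine c.induction (p := fun z => c.coeff i (c.refl i 1 z) = c.coeff (negIdx P i) z) (by simp)
    (fun j => ?_) (fun j => ?_) (fun u v hu hv => by simp [hu, hv]) (fun a v hv => by simp [hv]) z
  · have h : P.reflectionPerm i j = i ↔ j = negIdx P i := by
      rw [← reflectionPerm_self_eq, ← (P.reflectionPerm i).apply_eq_iff_eq (x := j),
        P.reflectionPerm_self]
    rw [refl_one_x, coeff_x, coeff_x]
    split_ifs <;> tauto
  · rw [coeff_h]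
    exact (congrArg _ (c.mono_h _ _ j)).trans (c.coeff_h _ _)

/-- If `ω + ω² = 1` and the automorphism `π` of the root system maps `i` to `-i`, then the
Frobenius maps twisted by `π` and by `s_i π` are conjugate. The conjugating element comes from the
matrix `h = (1, 1; ω, ω²)` of `SL₂`, whose Frobenius conjugate is `h` with its columns
interchanged. -/
theorem twistMap_conj {π : Equiv.Perm ι} (hπ : IsRootAut P π) {i : ι} (hi : π i = negIdx P i)
    {ω : K} (hω : ω ^ 2 = ω + 1) (z : 𝔤) :
    c.twistMap (P.reflectionPerm i * π) (c.rootMap (negIdx P i) ω (c.rootMap i 1 z)) =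
      c.rootMap (negIdx P i) ω (c.rootMap i 1 (c.twistMap π z)) := by
  have h1 : π (negIdx P i) = i := by rw [hπ.negIdx, hi, negIdx_negIdx]
  have hs : ∀ t z, c.refl i 1 (c.rootMap (negIdx P i) t z) = c.rootMap i t (c.refl i 1 z) := by
    intro t z
    have := c.rootMap_refl_one (negIdx P i) t z
    rwa [refl_negIdx_one, negIdx_negIdx] at this
  have hr : ∀ z, c.refl i 1 z = c.rootMap i 1 (c.rootMap (negIdx P i) 1 (c.rootMap i 1 z)) :=
    fun z => by rw [refl_one_eq]; rfl
  rw [← c.refl_twistMap hπ, c.twistMap_rootMap hπ, c.twistMap_rootMap hπ, h1, hi, rootMap_refl_one,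
    hs, hr, one_pow, rootMap_rootMap, CharTwo.add_self_eq_zero, rootMap_zero, rootMap_rootMap, hω,
    add_assoc, CharTwo.add_self_eq_zero, add_zero]

end ChevalleyBasis

namespace ChevalleyBasis

variable {ι M N : Type*} [AddCommGroup M] [Module ℚ M] [AddCommGroup N] [Module ℚ N]
  {P : RootPairing ι ℚ M N} [P.IsCrystallographic] {b : P.Base}
  {K 𝔤 : Type*} [Field K] [LieRing 𝔤] [LieAlgebra K 𝔤] (c : ChevalleyBasis b K 𝔤)
  [Finite ι] [P.IsReduced] [IsSimplyLaced P] [CharP K 2] [Fact (Nat.card K = 4)]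
  [Algebra (ZMod 2) K] [LieAlgebra (ZMod 2) 𝔤] [IsScalarTower (ZMod 2) K 𝔤]

/-! ### Forms over the field with two elements -/

/-- The Frobenius automorphism of `𝔤` over `𝔽₂` twisted by the automorphism `π` of the root
system. -/
noncomputable def twist {π : Equiv.Perm ι} (hπ : IsRootAut P π) : 𝔤 ≃ₗ⁅ZMod 2⁆ 𝔤 where
  toFun := c.twistMap π
  map_add' := map_add _
  map_smul' r z := ZMod.map_smul (c.twistMap π) r z
  map_lie' {u v} := c.twistMap_lie hπ u v
  invFun := c.twistMap π⁻¹
  left_inv z := c.twistMap_inv_apply hπ z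
  right_inv z := by
    have := c.twistMap_inv_apply hπ.inv z
    rwa [inv_inv] at this

@[simp] theorem twist_apply {π : Equiv.Perm ι} (hπ : IsRootAut P π) (z : 𝔤) :
    c.twist hπ z = c.twistMap π z := rfl

theorem isTwistedFrobenius_twist {π : Equiv.Perm ι} (hπ : IsRootAut P π)
    {τ : Equiv.Perm b.support} (h : ∀ i : b.support, π i = τ i) :
    c.IsTwistedFrobenius τ (c.twist hπ) where
  map_smul a v := by simp [map_smulₛₗ, frobenius_def]
  map_x i := by simp [h]
  map_x_neg i := by simp [hπ.negIdx, h]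

theorem mem_fixedPoints {σ : 𝔤 ≃ₗ⁅ZMod 2⁆ 𝔤} {z : 𝔤} : z ∈ fixedPoints σ ↔ σ z = z := Iff.rfl

/-- Conjugate automorphisms have isomorphic fixed algebras. -/
theorem nonempty_fixedPoints_equiv {σ σ' : 𝔤 ≃ₗ⁅ZMod 2⁆ 𝔤} {g : 𝔤 ≃ₗ[K] 𝔤}
    (hg : g ∈ autGroup K 𝔤) (h : ∀ z, σ' (g z) = g (σ z)) :
    Nonempty (fixedPoints σ ≃ₗ⁅ZMod 2⁆ fixedPoints σ') := by
  refine ⟨{ toFun := fun z => ⟨g z, ?_⟩, map_add' := fun u v => ?_, map_smul' := fun r v => ?_,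
            map_lie' := fun {u v} => ?_, invFun := fun z => ⟨g.symm z, ?_⟩,
            left_inv := fun z => ?_, right_inv := fun z => ?_ }⟩
  · rw [mem_fixedPoints, h, mem_fixedPoints.1 z.2]
  · exact Subtype.ext (map_add g _ _)
  · exact Subtype.ext (ZMod.map_smul g r (v : 𝔤))
  · exact Subtype.ext (hg _ _)
  · rw [mem_fixedPoints]
    apply g.injective
    rw [← h, g.apply_symm_apply, mem_fixedPoints.1 z.2]
  · exact Subtype.ext (g.symm_apply_apply _)
  · exact Subtype.ext (g.apply_symm_apply _)

variable (K) in
theorem exists_sq_eq_add_one : ∃ ω : K, ω ^ 2 = ω + 1 := by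
  obtain ⟨a, ha⟩ := exists_unit_ne_one K
  have h := one_add_unit_add_inv ha
  rw [← units_sq] at h
  have h2 : (2 : K) = 0 := CharTwo.two_eq_zero
  refine ⟨a, ?_⟩
  push_cast at h
  linear_combination h - h2 * (a + 1)

theorem pow_four (a : K) : a ^ 4 = a := by
  by_cases ha : a = 0
  · simp [ha]
  · have := congrArg Units.val (units_pow_three (Units.mk0 a ha))
    simp only [Units.val_pow_eq_pow_val, Units.val_mk0, Units.val_one] at this
    rw [pow_succ, this, one_mul]

theorem rootElement_mem_gTwo (i : ι) (ω : K) : c.rootElement i ω ∈ c.gTwo :=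
  LieSubalgebra.subset_lieSpan ⟨i, ω, rfl⟩

theorem h_mem_gTwo (i : ι) : c.h i ∈ c.gTwo := by
  obtain ⟨a, ha⟩ := exists_unit_ne_one K
  rw [← c.sum_rootElement i ha]
  exact add_mem (add_mem (c.rootElement_mem_gTwo _ _) (c.rootElement_mem_gTwo _ _))
    (c.rootElement_mem_gTwo _ _)

theorem smul_x_add_mem_gTwo (i : ι) (a : K) :
    a • c.x i + a ^ 2 • c.x (negIdx P i) ∈ c.gTwo := by
  by_cases ha : a = 0
  · simp [ha]
  · have h := sub_mem (c.rootElement_mem_gTwo i a) (c.h_mem_gTwo i)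
    have h1 : a * a ^ 2 = 1 := by
      apply mul_left_cancel₀ ha
      linear_combination pow_four a
    rwa [rootElement, h1, c.lie_x_neg, one_smul, add_sub_cancel_right] at h

theorem cartanPart_eq_sum (z : 𝔤) :
    c.cartanPart z = ∑ k : b.support, c.basis.repr z (Sum.inr k) • c.h k := by
  have h : c.cartanPart = ∑ k : b.support, (c.basis.coord (Sum.inr k)).smulRight (c.h k) := by
    refine c.basis.ext fun l => ?_
    simp only [LinearMap.sum_apply, LinearMap.smulRight_apply, Module.Basis.coord_apply,
      Module.Basis.repr_self]
    rcases l with i | k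
    · simp
    · rw [Finset.sum_eq_single k]
      · simp
      · intro l _ hl
        simp [hl.symm]
      · simp
  rw [h, LinearMap.sum_apply]
  rfl

/-- The Frobenius map twisted by `-1` acts on the coordinates of the Cartan part by squaring, since
`h (-i) = h i`. -/
theorem repr_twistMap_negPerm (z : 𝔤) (k : b.support) :
    c.basis.repr (c.twistMap (negPerm P) z) (Sum.inr k) = c.basis.repr z (Sum.inr k) ^ 2 := by
  have h : c.basis.coord (Sum.inr k) ∘ₗ c.monoMap (negPerm P) 1 = c.basis.coord (Sum.inr k) := by
    refine c.basis.ext fun l => ?_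
    rcases l with i | l
    · rw [LinearMap.comp_apply, Module.Basis.coord_apply, Module.Basis.coord_apply, basis_inl,
        monoMap_x, negPerm_apply, Pi.one_apply, Units.val_one, one_smul, ← basis_inl, ← basis_inl,
        Module.Basis.repr_self, Module.Basis.repr_self, Finsupp.single_eq_of_ne (by simp),
        Finsupp.single_eq_of_ne (by simp)]
    · rw [LinearMap.comp_apply, basis_inr, c.monoMap_h (isRootAut_negPerm P), negPerm_apply,
        c.isEvenAdditive_h.neg]
  have h1 : c.basis.repr (c.monoMap (negPerm P) 1 (c.frob z)) (Sum.inr k) =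
      c.basis.repr (c.frob z) (Sum.inr k) := LinearMap.congr_fun h (c.frob z)
  rw [← repr_frob, ← h1]
  rfl

/-- `𝔤₂` is the fixed algebra of the Frobenius map twisted by `-1`. -/
theorem gTwo_eq_fixedPoints : c.gTwo = fixedPoints (c.twist (isRootAut_negPerm P)) := by
  apply le_antisymm
  · refine LieSubalgebra.lieSpan_le.2 ?_
    rintro _ ⟨i, ω, rfl⟩
    rw [SetLike.mem_coe, mem_fixedPoints, twist_apply]
    have h6 : (ω * ω ^ 2) ^ 2 = ω * ω ^ 2 := by linear_combination ω ^ 2 * pow_four ω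
    rw [rootElement, c.lie_x_neg]
    simp only [map_add, map_smulₛₗ, twistMap_x, negPerm_apply, negIdx_negIdx, frobenius_def,
      c.twistMap_h (isRootAut_negPerm P), c.isEvenAdditive_h.neg, h6, ← pow_mul]
    norm_num only
    rw [pow_four, add_comm (_ • _)]
  · intro z hz
    rw [mem_fixedPoints, twist_apply] at hz
    have := Fintype.ofFinite ι
    obtain ⟨ω, hω⟩ := exists_sq_eq_add_one K
    have hc : ∀ i, c.coeff (negIdx P i) z = c.coeff i z ^ 2 := fun i => by
      have := c.coeff_twistMap (isRootAut_negPerm P) i z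
      rwa [hz] at this
    -- With `ω + ω² = 1`, the part of `z` in the root spaces is the sum over all roots `i`
    -- of the elements `a x_i + a² x_{-i}` for `a = ω z_i`.
    have h1 : ∑ i, c.coeff i z • c.x i = ∑ i, ((ω * c.coeff i z) • c.x i +
        (ω * c.coeff i z) ^ 2 • c.x (negIdx P i)) := by
      rw [Finset.sum_add_distrib]
      have h2 : ∑ i, (ω * c.coeff i z) ^ 2 • c.x (negIdx P i) =
          ∑ i, (ω ^ 2 * c.coeff i z) • c.x i := by
        rw [← Equiv.sum_comp (negPerm P) fun i => (ω ^ 2 * c.coeff i z) • c.x i]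
        simp only [negPerm_apply, hc, mul_pow]
      rw [h2, ← Finset.sum_add_distrib]
      refine Finset.sum_congr rfl fun i _ => ?_
      rw [← add_smul]
      congr 1
      have h2 : (2 : K) = 0 := CharTwo.two_eq_zero
      linear_combination -c.coeff i z * hω - c.coeff i z * ω * h2
    rw [← c.sum_coeff_add_cartanPart z, h1, cartanPart_eq_sum]
    refine add_mem (sum_mem fun i _ => c.smul_x_add_mem_gTwo _ _) (sum_mem fun k _ => ?_)
    have h3 := c.repr_twistMap_negPerm z k
    rw [hz] at h3
    have h4 : c.basis.repr z (Sum.inr k) * (c.basis.repr z (Sum.inr k) - 1) = 0 := by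
      linear_combination -h3
    rcases mul_eq_zero.1 h4 with h | h
    · rw [h, zero_smul]; exact zero_mem _
    · rw [sub_eq_zero.1 h, one_smul]; exact c.h_mem_gTwo _

/-- Twisting by `-1` can be replaced by twisting by the product of `-1` and of the reflections in
any set of pairwise orthogonal roots. -/
theorem exists_twist_conj {J : Type*} (β : J → ι)
    (hβ : ∀ j j', j ≠ j' → P.pairingIn ℤ (β j) (β j') = 0) (S : Finset J) :
    ∃ (ρ : Equiv.Perm ι) (hρ : IsRootAut P ρ),
      (∀ i, P.root (ρ i) =
        -P.root i + ∑ j ∈ S, P.pairingIn ℤ i (β j) • P.root (β j)) ∧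
      ∃ g ∈ autGroup K 𝔤, ∀ z, c.twist hρ (g z) = g (c.twist (isRootAut_negPerm P) z) := by
  classical
  induction S using Finset.induction_on with
  | empty =>
    exact ⟨negPerm P, isRootAut_negPerm P, fun i => by simp [root_negIdx], 1, one_mem _,
      fun z => rfl⟩
  | insert j S hj ih =>
    obtain ⟨ρ, hρ, hroot, g, hg, hz⟩ := ih
    obtain ⟨ω, hω⟩ := exists_sq_eq_add_one K
    have hS : ∀ j' ∈ S, j' ≠ j := fun j' hj' h => hj (h ▸ hj')
    have hj1 : ρ (β j) = negIdx P (β j) := by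
      apply P.root.injective
      rw [hroot, root_negIdx, Finset.sum_eq_zero, add_zero]
      intro j' hj'
      rw [hβ j j' (hS j' hj').symm, zero_smul]
    refine ⟨P.reflectionPerm (β j) * ρ, (isRootAut_reflectionPerm P _).mul hρ, fun i => ?_,
      c.rootAut (negIdx P (β j)) ω * c.rootAut (β j) 1 * g,
      mul_mem (mul_mem (c.rootAut_mem_autGroup _ _) (c.rootAut_mem_autGroup _ _)) hg, fun z => ?_⟩
    · have h1 : P.pairingIn ℤ (ρ i) (β j) = -P.pairingIn ℤ i (β j) := by
        have := hρ i (β j)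
        rw [hj1, pairingIn_negIdx_right] at this
        omega
      rw [Equiv.Perm.mul_apply, root_reflectionPerm_int, hroot, h1, Finset.sum_insert hj]
      module
    · have h1 := c.twistMap_conj hρ hj1 hω (g z)
      have h2 : c.twistMap ρ (g z) = g (c.twistMap (negPerm P) z) := hz z
      rw [h2] at h1
      exact h1

/-- If `-1` times the product of the reflections in pairwise orthogonal roots `β j` permutes the
simple roots as `τ` does, then `𝔤₂` is the fixed algebra of the Frobenius map twisted by `τ`. -/
theorem exists_isTwistedFrobenius {J : Type*} [Fintype J] (β : J → ι)
    (hβ : ∀ j j', j ≠ j' → P.pairingIn ℤ (β j) (β j') = 0) (τ : Equiv.Perm b.support)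
    (hτ : ∀ i : b.support, P.root (τ i) + P.root i =
      ∑ j, P.pairingIn ℤ i (β j) • P.root (β j)) :
    ∃ σ : 𝔤 ≃ₗ⁅ZMod 2⁆ 𝔤, c.IsTwistedFrobenius τ σ ∧
      Nonempty (c.gTwo ≃ₗ⁅ZMod 2⁆ fixedPoints σ) := by
  obtain ⟨ρ, hρ, hroot, g, hg, hz⟩ := c.exists_twist_conj β hβ Finset.univ
  refine ⟨c.twist hρ, c.isTwistedFrobenius_twist hρ fun i => ?_, ?_⟩
  · apply P.root.injective
    rw [hroot, ← hτ]
    abel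
  · rw [gTwo_eq_fixedPoints]
    exact nonempty_fixedPoints_equiv hg hz

end ChevalleyBasis

/-! ### Root systems of type `A`, `D` and `E` -/

namespace DynkinType

theorem cartan_symm (X : DynkinType) (k l : Fin X.rank) : X.cartan k l = X.cartan l k := by
  cases X with
  | A n hn => exact congrFun₂ (CartanMatrix.A_transpose n).symm k l
  | D n hn => exact congrFun₂ (CartanMatrix.D_transpose n).symm k l
  | E6 => exact congrFun₂ CartanMatrix.E₆_transpose.symm k l
  | E7 => exact congrFun₂ CartanMatrix.E₇_transpose.symm k l
  | E8 => exact congrFun₂ CartanMatrix.E₈_transpose.symm k l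

/-- The Dynkin diagrams are connected: some numbering `f` of the nodes makes every node except for
`k₀` adjacent to a node with a smaller number. -/
theorem exists_adjacent (X : DynkinType) : ∃ (f : Fin X.rank → ℕ) (k₀ : Fin X.rank),
    ∀ k, k ≠ k₀ → ∃ l, f l < f k ∧ X.cartan k l = -1 := by
  cases X with
  | A n hn =>
    refine ⟨fun k : Fin n => k, (⟨0, hn⟩ : Fin n), fun (k : Fin n) hk => ?_⟩
    have h0 : (k : ℕ) ≠ 0 := fun h => hk (Fin.ext h)
    refine ⟨(⟨k - 1, by omega⟩ : Fin n), by simp; omega, ?_⟩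
    simp only [cartan, CartanMatrix.A, Matrix.of_apply, Fin.ext_iff]
    split_ifs <;> omega
  | D n hn =>
    refine ⟨fun k : Fin n => k, (⟨0, by omega⟩ : Fin n), fun (k : Fin n) hk => ?_⟩
    have h0 : (k : ℕ) ≠ 0 := fun h => hk (Fin.ext h)
    by_cases h1 : (k : ℕ) = n - 1
    · refine ⟨(⟨k - 2, by omega⟩ : Fin n), by simp; omega, ?_⟩
      simp only [cartan, CartanMatrix.D, Matrix.of_apply, Fin.ext_iff]
      split_ifs <;> omega
    · refine ⟨(⟨k - 1, by omega⟩ : Fin n), by simp; omega, ?_⟩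
      simp only [cartan, CartanMatrix.D, Matrix.of_apply, Fin.ext_iff]
      split_ifs <;> omega
  | E6 =>
    let g : Fin 6 → Fin 6 := ![2, 3, 3, 4, 5, 5]
    have h : ∀ k : Fin 6, k ≠ 5 →
        5 - (g k : ℕ) < 5 - (k : ℕ) ∧ CartanMatrix.E₆ k (g k) = -1 := by decide
    exact ⟨fun k : Fin 6 => 5 - k, (5 : Fin 6), fun k hk => ⟨_, h k hk⟩⟩
  | E7 =>
    let g : Fin 7 → Fin 7 := ![2, 3, 3, 4, 5, 6, 6]
    have h : ∀ k : Fin 7, k ≠ 6 →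
        6 - (g k : ℕ) < 6 - (k : ℕ) ∧ CartanMatrix.E₇ k (g k) = -1 := by decide
    exact ⟨fun k : Fin 7 => 6 - k, (6 : Fin 7), fun k hk => ⟨_, h k hk⟩⟩
  | E8 =>
    let g : Fin 8 → Fin 8 := ![2, 3, 3, 4, 5, 6, 7, 7]
    have h : ∀ k : Fin 8, k ≠ 7 →
        7 - (g k : ℕ) < 7 - (k : ℕ) ∧ CartanMatrix.E₈ k (g k) = -1 := by decide
    exact ⟨fun k : Fin 8 => 7 - k, (7 : Fin 8), fun k hk => ⟨_, h k hk⟩⟩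

end DynkinType

namespace Numbering

variable {ι M N : Type*} [AddCommGroup M] [Module ℚ M] [AddCommGroup N] [Module ℚ N]
  {P : RootPairing ι ℚ M N} [P.IsCrystallographic] {b : P.Base} {X : DynkinType}
  (ν : Numbering b X)
include ν

theorem pairingIn_node (k l : Fin X.rank) :
    P.pairingIn ℤ (ν.node k) (ν.node l) = X.cartan k l := ν.cartanMatrix_eq k l

/-- Two adjacent simple roots are conjugate under the Weyl group, and every root is conjugate to a
simple root; so the connectedness of the diagram implies transitivity. -/
theorem isWeylTransitive [Finite ι] [P.IsReduced] : IsWeylTransitive P where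
  out Q hQ i hi j := by
    have hQ' : ∀ i j, Q (P.reflectionPerm j i) → Q i := fun i j h => by
      simpa using hQ _ j h
    have hadj : ∀ k l, X.cartan k l = -1 → Q (ν.node k) → Q (ν.node l) := fun k l h hk => by
      have h1 := hQ _ (ν.node k) (hQ _ (ν.node l) hk)
      convert h1 using 1
      apply P.root.injective
      rw [root_reflectionPerm_int, pairingIn_reflectionPerm_left, root_reflectionPerm_int,
        P.pairingIn_same, ν.pairingIn_node, ν.pairingIn_node, X.cartan_symm l k, h]
      module
    obtain ⟨f, k₀, hf⟩ := X.exists_adjacent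
    have hk₀ : ∀ k, Q (ν.node k) ↔ Q (ν.node k₀) := by
      intro k
      induction hm : f k using Nat.strong_induction_on generalizing k with
      | _ m ih =>
        by_cases hk : k = k₀
        · rw [hk]
        · obtain ⟨l, hl, hkl⟩ := hf k hk
          exact ⟨fun h => (ih _ (hm ▸ hl) l rfl).1 (hadj k l hkl h),
            fun h => hadj l k (X.cartan_symm k l ▸ hkl) ((ih _ (hm ▸ hl) l rfl).2 h)⟩
    have hs : ∀ i ∈ b.support, Q i ↔ Q (ν.node k₀) := fun i hi => by
      simpa using hk₀ (ν.node.symm ⟨i, hi⟩)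
    have key : ∀ i, Q i ↔ Q (ν.node k₀) := fun i => by
      refine b.induction_reflect i (p := fun i => Q i ↔ Q (ν.node k₀)) (fun i h => ?_) hs
        (fun i j h _ => ?_)
      · exact ⟨fun h' => h.1 (hQ' _ _ h'), fun h' => hQ _ _ (h.2 h')⟩
      · exact ⟨fun h' => h.1 (hQ' _ _ h'), fun h' => hQ _ _ (h.2 h')⟩
    exact (key j).2 ((key i).1 hi)

/-- All roots have the same length, since the Weyl group is transitive on them. -/
theorem isSimplyLaced [Finite ι] [P.IsReduced] : IsSimplyLaced P where
  symm i j := by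
    have := Fintype.ofFinite ι
    have := ν.isWeylTransitive
    let B := P.toInvariantForm
    have h : B.form (P.root i) (P.root i) = B.form (P.root j) (P.root j) := by
      refine IsWeylTransitive.out (P := P)
        (fun k => B.form (P.root k) (P.root k) = B.form (P.root j) (P.root j))
        (fun k l h => ?_) j rfl i
      rw [P.root_reflectionPerm, B.isOrthogonal_reflection l]
      exact h
    have h1 := B.pairing_mul_eq_pairing_mul_swap j i
    rw [h] at h1
    have h2 := mul_right_cancel₀ (B.ne_zero j) h1
    rw [← P.algebraMap_pairingIn ℤ, ← P.algebraMap_pairingIn ℤ] at h2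
    exact_mod_cast h2

end Numbering

section OrthogonalRoots

variable {ι M N : Type*} [AddCommGroup M] [Module ℚ M] [AddCommGroup N] [Module ℚ N]
  {P : RootPairing ι ℚ M N} [P.IsCrystallographic]

theorem cast_pairingIn (i j : ι) : (P.pairingIn ℤ i j : ℚ) = P.coroot' j (P.root i) := by
  rw [P.root_coroot'_eq_pairing, ← P.algebraMap_pairingIn ℤ]
  rfl

theorem pairingIn_eq_sum {κ : Type*} {s : Finset κ} {v : κ → ℤ} {α : κ → ι} {i : ι}
    (h : P.root i = ∑ k ∈ s, v k • P.root (α k)) (j : ι) :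
    P.pairingIn ℤ i j = ∑ k ∈ s, v k * P.pairingIn ℤ (α k) j := by
  have h1 : (P.pairingIn ℤ i j : ℚ) = ∑ k ∈ s, (v k : ℚ) * P.pairingIn ℤ (α k) j := by
    simp [cast_pairingIn, h]
  exact_mod_cast h1

/-! ### Orthogonal roots in type `E` -/

/-- A word in the simple roots is a root word, with respect to a Cartan matrix `C`, if it can be
read from right to left as a way to build a root by adding simple roots one by one, such that each
new simple root has the Cartan integer `-1` with the sum of the ones before it. -/
def isRootWord {r : ℕ} (C : Matrix (Fin r) (Fin r) ℤ) : List (Fin r) → Bool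
  | [] => false
  | [_] => true
  | k :: w => isRootWord C w && (w.map fun l => C l k).sum == -1

variable [Finite ι] [P.IsReduced] [IsSimplyLaced P]

/-- The sum of the letters of a root word is a root. -/
theorem exists_root_eq_sum {r : ℕ} {C : Matrix (Fin r) (Fin r) ℤ} {α : Fin r → ι}
    (hα : ∀ k l, P.pairingIn ℤ (α k) (α l) = C k l) (w : List (Fin r))
    (hw : isRootWord C w = true) :
    ∃ β, P.root β = (w.map fun k => P.root (α k)).sum ∧
      ∀ k, P.pairingIn ℤ β (α k) = (w.map fun l => C l k).sum := by
  induction w with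
  | nil => simp [isRootWord] at hw
  | cons k w ih =>
    by_cases hn : w = []
    · subst hn
      exact ⟨α k, by simp, by simp [hα]⟩
    · rw [isRootWord.eq_3 C k w hn, Bool.and_eq_true, beq_iff_eq] at hw
      obtain ⟨β, h1, h2⟩ := ih hw.1
      have h3 : P.pairingIn ℤ β (α k) = -1 := by rw [h2, hw.2]
      refine ⟨P.reflectionPerm (α k) β, ?_, fun l => ?_⟩
      · rw [root_reflectionPerm_int, h3, h1, List.map_cons, List.sum_cons]
        module
      · rw [pairingIn_reflectionPerm_left, h3, h2, hα, List.map_cons, List.sum_cons]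
        ring

theorem sum_map_eq_sum_count {r : ℕ} {A : Type*} [AddCommGroup A] (w : List (Fin r))
    (f : Fin r → A) : (w.map f).sum = ∑ k, (w.count k : ℤ) • f k := by
  rw [Finset.sum_list_map_count]
  simp only [natCast_zsmul]
  refine Finset.sum_subset (Finset.subset_univ _) fun k _ hk => ?_
  rw [List.count_eq_zero_of_not_mem (by simpa using hk), zero_smul]

/-- Roots with coefficient vectors `v j`, given by root words `w j`, are pairwise orthogonal and
induce the permutation `τ` of the simple roots as soon as the corresponding identities for the
vectors and the Cartan matrix `C` hold. -/
theorem exists_orthogonal_of_words {r m : ℕ} {C : Matrix (Fin r) (Fin r) ℤ} {α : Fin r → ι}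
    (hα : ∀ k l, P.pairingIn ℤ (α k) (α l) = C k l) (w : Fin m → List (Fin r))
    (hw : ∀ j, isRootWord C (w j) = true) (v : Fin m → Fin r → ℤ)
    (hv : ∀ j k, (w j).count k = v j k)
    (hvC : ∀ j j', j ≠ j' → ∑ k, v j k * ∑ l, v j' l * C k l = 0) {τ : Fin r → Fin r}
    (hτ : ∀ k l, (if l = τ k then 1 else 0) + (if l = k then 1 else 0) =
      ∑ j, (∑ i, v j i * C k i) * v j l) :
    ∃ β : Fin m → ι, (∀ j j', j ≠ j' → P.pairingIn ℤ (β j) (β j') = 0) ∧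
      ∀ k, P.root (α (τ k)) + P.root (α k) =
        ∑ j, P.pairingIn ℤ (α k) (β j) • P.root (β j) := by
  choose β hβ _ using fun j => exists_root_eq_sum hα (w j) (hw j)
  have h1 : ∀ j, P.root (β j) = ∑ k, v j k • P.root (α k) := fun j => by
    rw [hβ, sum_map_eq_sum_count]
    simp only [hv]
  have h2 : ∀ j k, P.pairingIn ℤ (α k) (β j) = ∑ i, v j i * C k i := fun j k => by
    rw [pairingIn_comm, pairingIn_eq_sum (h1 j)]
    exact Finset.sum_congr rfl fun i _ => by rw [pairingIn_comm, hα]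
  refine ⟨β, fun j j' hj => ?_, fun k => ?_⟩
  · rw [pairingIn_eq_sum (h1 j)]
    simp only [h2, hvC j j' hj]
  · simp only [h1, h2, Finset.smul_sum, smul_smul]
    rw [Finset.sum_comm]
    simp only [← Finset.sum_smul, ← hτ, add_smul, Finset.sum_add_distrib]
    simp

/-- The four roots, given by root words and by their coefficients, are the highest root, the highest
roots of the subsystems of type `A₅` and `A₃` that are orthogonal to the ones before, and the
simple root in the centre of the diagram. -/
theorem exists_orthogonal_E6 {α : Fin 6 → ι}
    (hα : ∀ k l, P.pairingIn ℤ (α k) (α l) = CartanMatrix.E₆ k l) :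
    ∃ β : Fin 4 → ι, (∀ j j', j ≠ j' → P.pairingIn ℤ (β j) (β j') = 0) ∧
      ∀ k, P.root (α ((Equiv.swap 0 5 * Equiv.swap 2 4 : Equiv.Perm (Fin 6)) k)) + P.root (α k) =
        ∑ j, P.pairingIn ℤ (α k) (β j) • P.root (β j) :=
  exists_orthogonal_of_words hα
    ![[1, 3, 2, 0, 4, 3, 1, 2, 3, 4, 5], [0, 2, 3, 4, 5], [2, 3, 4], [3]] (by decide)
    ![![1, 2, 2, 3, 2, 1], ![1, 0, 1, 1, 1, 1], ![0, 0, 1, 1, 1, 0], ![0, 0, 0, 1, 0, 0]]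
    (by decide) (by decide) (by decide)

/-- The seven roots form a subsystem of type `A₁⁷`, so that the product of their reflections is
`-1`. -/
theorem exists_orthogonal_E7 {α : Fin 7 → ι}
    (hα : ∀ k l, P.pairingIn ℤ (α k) (α l) = CartanMatrix.E₇ k l) :
    ∃ β : Fin 7 → ι, (∀ j j', j ≠ j' → P.pairingIn ℤ (β j) (β j') = 0) ∧
      ∀ k, P.root (α k) + P.root (α k) = ∑ j, P.pairingIn ℤ (α k) (β j) • P.root (β j) :=
  exists_orthogonal_of_words (τ := id) hα
    ![[1], [2], [4], [6], [3, 1, 2, 3, 4], [5, 4, 3, 1, 2, 3, 4, 5, 6],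
      [0, 2, 3, 1, 4, 3, 2, 0, 5, 4, 3, 1, 2, 3, 4, 5, 6]] (by decide)
    ![![0, 1, 0, 0, 0, 0, 0], ![0, 0, 1, 0, 0, 0, 0], ![0, 0, 0, 0, 1, 0, 0],
      ![0, 0, 0, 0, 0, 0, 1], ![0, 1, 1, 2, 1, 0, 0], ![0, 1, 1, 2, 2, 2, 1],
      ![2, 2, 3, 4, 3, 2, 1]]
    (by decide) (by decide +kernel) (by decide +kernel)

/-- To the seven roots in the subsystem of type `E₇` the highest root is added, which is orthogonal
to that subsystem. -/
theorem exists_orthogonal_E8 {α : Fin 8 → ι}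
    (hα : ∀ k l, P.pairingIn ℤ (α k) (α l) = CartanMatrix.E₈ k l) :
    ∃ β : Fin 8 → ι, (∀ j j', j ≠ j' → P.pairingIn ℤ (β j) (β j') = 0) ∧
      ∀ k, P.root (α k) + P.root (α k) = ∑ j, P.pairingIn ℤ (α k) (β j) • P.root (β j) :=
  exists_orthogonal_of_words (τ := id) hα
    ![[1], [2], [4], [6], [3, 1, 2, 3, 4], [5, 4, 3, 1, 2, 3, 4, 5, 6],
      [0, 2, 3, 1, 4, 3, 2, 0, 5, 4, 3, 1, 2, 3, 4, 5, 6],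
      [7, 6, 5, 4, 3, 1, 2, 0, 3, 2, 4, 3, 1, 5, 4, 3, 2, 0, 6, 5, 4, 3, 1, 2, 3, 4, 5, 6, 7]]
    (by decide +kernel)
    ![![0, 1, 0, 0, 0, 0, 0, 0], ![0, 0, 1, 0, 0, 0, 0, 0], ![0, 0, 0, 0, 1, 0, 0, 0],
      ![0, 0, 0, 0, 0, 0, 1, 0], ![0, 1, 1, 2, 1, 0, 0, 0], ![0, 1, 1, 2, 2, 2, 1, 0],
      ![2, 2, 3, 4, 3, 2, 1, 0], ![2, 3, 4, 6, 5, 4, 3, 2]]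
    (by decide +kernel) (by decide +kernel) (by decide +kernel)

end OrthogonalRoots

section OrthogonalRoots

variable {ι M N : Type*} [AddCommGroup M] [Module ℚ M] [AddCommGroup N] [Module ℚ N]
  {P : RootPairing ι ℚ M N} [P.IsCrystallographic] [Finite ι] [P.IsReduced] [IsSimplyLaced P]

/-! ### Orthogonal roots in types `A` and `D` -/

/-- If a root and a coroot have product `-1`, the sum of the two roots is a root, and its coroot is
the sum of the coroots. -/
theorem exists_root_add {i j : ι} (h : P.coroot' i (P.root j) = -1) :
    ∃ k, P.root k = P.root i + P.root j ∧ ∀ x, P.coroot' k x = P.coroot' i x + P.coroot' j x := by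
  have h1 : P.pairingIn ℤ j i = -1 := by
    rw [← cast_pairingIn] at h
    exact_mod_cast h
  refine ⟨P.reflectionPerm j i, ?_, fun x => ?_⟩
  · rw [root_reflectionPerm_int, pairingIn_comm, h1]
    module
  · rw [RootPairing.coroot', RootPairing.coroot', RootPairing.coroot', coroot_reflectionPerm_int,
      h1]
    simp

/-- The sum of the maps `x ↦ ⟨x, β⟩ β`, for a family of roots `β`. For pairwise orthogonal roots,
this is `1` minus the product of the reflections. -/
noncomputable def sumReflections (P : RootPairing ι ℚ M N) {J : Type*} [Fintype J] (β : J → ι) :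
    M →ₗ[ℚ] M :=
  ∑ j, (P.coroot' (β j)).smulRight (P.root (β j))

theorem sumReflections_apply {J : Type*} [Fintype J] (β : J → ι) (x : M) :
    sumReflections P β x = ∑ j, P.coroot' (β j) x • P.root (β j) := by
  simp [sumReflections]

theorem sumReflections_root {J : Type*} [Fintype J] (β : J → ι) (i : ι) :
    sumReflections P β (P.root i) = ∑ j, P.pairingIn ℤ i (β j) • P.root (β j) := by
  simp only [sumReflections_apply, ← cast_pairingIn, Int.cast_smul_eq_zsmul]

/-- The indicator function of a point. -/
def delta (i m : ℕ) : ℚ := if m = i then 1 else 0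

/-- The simple roots `α` as a sequence of vectors, with `0` for the indices out of range. -/
def simpleVec (P : RootPairing ι ℚ M N) {n : ℕ} (α : Fin n → ι) (l : ℕ) : M :=
  if h : l < n then P.root (α ⟨l, h⟩) else 0

theorem simpleVec_of_lt {n : ℕ} (α : Fin n → ι) {l : ℕ} (h : l < n) :
    simpleVec P α l = P.root (α ⟨l, h⟩) := dif_pos h

section TypeA

/-- The vectors `α₀ + ⋯ + αₘ₋₁`; in type `A` the roots are their differences. -/
def partialSum (P : RootPairing ι ℚ M N) {n : ℕ} (α : Fin n → ι) (m : ℕ) : M :=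
  ∑ l ∈ Finset.range m, simpleVec P α l

variable {n : ℕ} {α : Fin n → ι}

theorem partialSum_succ {m : ℕ} (h : m < n) :
    partialSum P α (m + 1) = partialSum P α m + P.root (α ⟨m, h⟩) := by
  rw [partialSum, Finset.sum_range_succ, simpleVec_of_lt α h]
  rfl

variable (hα : ∀ k l, P.pairingIn ℤ (α k) (α l) = CartanMatrix.A n k l)
include hα

theorem coroot_partialSum {k : ℕ} (hk : k < n) {m : ℕ} (hm : m ≤ n) :
    P.coroot' (α ⟨k, hk⟩) (partialSum P α m) =
      (delta (k + 1) m - delta k m) - (delta (k + 1) 0 - delta k 0) := by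
  induction m with
  | zero => simp [partialSum]
  | succ m ih =>
    rw [partialSum_succ hm, map_add, ih (by omega), ← cast_pairingIn, hα]
    simp only [CartanMatrix.A, Matrix.of_apply, delta, Fin.ext_iff]
    split_ifs <;> first | omega | norm_num

/-- The root `αᵢ + ⋯ + αⱼ₋₁`, built by adding one simple root at a time, together with its coroot as
a functional. -/
theorem exists_root_eq_partialSum_sub {i j : ℕ} (hij : i < j) (hj : j ≤ n) :
    ∃ β, P.root β = partialSum P α j - partialSum P α i ∧ ∀ m ≤ n,
      P.coroot' β (partialSum P α m) = (delta j m - delta i m) - (delta j 0 - delta i 0) := by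
  induction j, hij using Nat.le_induction with
  | base =>
    exact ⟨α ⟨i, hj⟩, by rw [partialSum_succ hj, add_sub_cancel_left],
      fun m hm => coroot_partialSum hα hj hm⟩
  | succ j hij ih =>
    obtain ⟨β, h1, h2⟩ := ih (by omega)
    have h3 : P.root (α ⟨j, hj⟩) = partialSum P α (j + 1) - partialSum P α j := by
      rw [partialSum_succ hj, add_sub_cancel_left]
    have h4 : P.coroot' β (P.root (α ⟨j, hj⟩)) = -1 := by
      rw [h3, map_sub, h2 _ hj, h2 _ (by omega)]
      simp only [delta]
      split_ifs <;> first | omega | norm_num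
    obtain ⟨γ, h5, h6⟩ := exists_root_add h4
    refine ⟨γ, by rw [h5, h1, h3]; abel, fun m hm => ?_⟩
    rw [h6, h2 m hm, coroot_partialSum hα hj hm]
    ring

/-- In type `A` the roots `αₖ + ⋯ + αₙ₋₁₋ₖ` are pairwise orthogonal, and the product of their
reflections is `-1` times the reversal of the diagram. -/
theorem exists_orthogonal_A :
    ∃ β : Fin ((n + 1) / 2) → ι, (∀ j j', j ≠ j' → P.pairingIn ℤ (β j) (β j') = 0) ∧
      ∀ k, P.root (α (Fin.revPerm k)) + P.root (α k) =
        ∑ j, P.pairingIn ℤ (α k) (β j) • P.root (β j) := by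
  choose β hβ hβ' using fun k : Fin ((n + 1) / 2) =>
    exists_root_eq_partialSum_sub hα (i := k) (j := n - k) (by omega) (by omega)
  have hT : ∀ m ≤ n, ∑ k : Fin ((n + 1) / 2), (delta (n - k) m - delta k m) • P.root (β k) =
      partialSum P α m - partialSum P α (n - m) := by
    intro m hm
    rcases lt_trichotomy (2 * m) n with h | h | h
    · rw [Finset.sum_eq_single ⟨m, by omega⟩]
      · rw [hβ]
        simp only [delta, if_true, if_neg (show m ≠ n - m by omega)]
        module
      · intro k _ hk
        have h1 : m ≠ k := fun h => hk (Fin.ext h.symm)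
        simp only [delta, if_neg h1, if_neg (show m ≠ n - k by omega)]
        simp
      · simp
    · rw [show n - m = m by omega, sub_self]
      refine Finset.sum_eq_zero fun k _ => ?_
      simp only [delta, if_neg (show m ≠ k by omega), if_neg (show m ≠ n - k by omega)]
      simp
    · rw [Finset.sum_eq_single ⟨n - m, by omega⟩]
      · rw [hβ]
        simp only [delta, show n - (n - m) = m by omega, if_true,
          if_neg (show m ≠ n - m by omega)]
        module
      · intro k _ hk
        have h1 : (k : ℕ) ≠ n - m := fun h => hk (Fin.ext h)
        simp only [delta, if_neg (show m ≠ k by omega), if_neg (show m ≠ n - k by omega)]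
        simp
      · simp
  refine ⟨β, fun j j' hj => ?_, fun c => ?_⟩
  · have hj' : (j : ℕ) ≠ j' := fun h => hj (Fin.ext h)
    have h1 : (P.pairingIn ℤ (β j) (β j') : ℚ) = 0 := by
      rw [cast_pairingIn, hβ, map_sub, hβ' _ _ (by omega), hβ' _ _ (by omega)]
      simp only [delta]
      split_ifs <;> first | omega | norm_num
    exact_mod_cast h1
  · have h3 : ∀ c : Fin n, P.root (α c) = partialSum P α (c + 1) - partialSum P α c := fun c => by
      rw [partialSum_succ c.2, add_sub_cancel_left]
    have h4 : ∀ k, P.coroot' (β k) (P.root (α c)) = (delta (n - k) (c + 1) - delta k (c + 1)) -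
        (delta (n - k) c - delta k c) := fun k => by
      rw [h3, map_sub, hβ' _ _ (by omega), hβ' _ _ (by omega)]
      ring
    rw [← sumReflections_root, sumReflections_apply]
    simp only [h4, sub_smul _ (delta _ _ - delta _ _), Finset.sum_sub_distrib]
    rw [hT _ (by omega), hT _ (by omega), h3, h3, Fin.revPerm_apply, Fin.val_rev,
      show n - (c + 1) + 1 = n - c by omega]
    abel

end TypeA

section TypeD

/-- The standard orthogonal vectors `εₘ` in type `D`, which are expressed by the simple roots
`αₘ = εₘ - εₘ₊₁` for `m < n - 1` and `αₙ₋₁ = εₙ₋₂ + εₙ₋₁`. -/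
def epsilon (P : RootPairing ι ℚ M N) {n : ℕ} (α : Fin n → ι) (m : ℕ) : M :=
  (2⁻¹ : ℚ) • (simpleVec P α (n - 1) - simpleVec P α (n - 2)) +
    ∑ l ∈ Finset.Ico m (n - 1), simpleVec P α l

variable {n : ℕ} {α : Fin n → ι}

theorem root_eq_epsilon_sub {m : ℕ} (h : m + 1 < n) :
    P.root (α ⟨m, by omega⟩) = epsilon P α m - epsilon P α (m + 1) := by
  rw [← simpleVec_of_lt, epsilon, epsilon, Finset.sum_eq_sum_Ico_succ_bot (by omega)]
  abel

theorem root_eq_epsilon_add (h : 2 ≤ n) :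
    P.root (α ⟨n - 1, by omega⟩) = epsilon P α (n - 2) + epsilon P α (n - 1) := by
  have h1 : Finset.Ico (n - 2) (n - 1) = {n - 2} := by
    ext
    simp
    omega
  rw [← simpleVec_of_lt, epsilon, epsilon, Finset.Ico_self, Finset.sum_empty, h1,
    Finset.sum_singleton]
  module

/-- The values of a linear functional on the vectors `εₘ` can be read off from its values on the
simple roots. -/
theorem map_epsilon (hn : 2 ≤ n) (φ : M →ₗ[ℚ] ℚ) (f : ℕ → ℚ)
    (h1 : ∀ (m : ℕ) (hm : m + 1 < n), φ (P.root (α ⟨m, by omega⟩)) = f m - f (m + 1))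
    (h2 : φ (P.root (α ⟨n - 1, by omega⟩)) = f (n - 2) + f (n - 1)) {m : ℕ} (hm : m < n) :
    φ (epsilon P α m) = f m := by
  have key : ∀ m, m + 1 < n →
      φ (epsilon P α m) - φ (epsilon P α (m + 1)) = f m - f (m + 1) := fun m hm => by
    rw [← map_sub, ← root_eq_epsilon_sub hm, h1 m hm]
  have h3 := key (n - 2) (by omega)
  rw [root_eq_epsilon_add hn, map_add] at h2
  rw [show n - 2 + 1 = n - 1 by omega] at h3
  obtain ⟨d, rfl⟩ : ∃ d, m = n - 1 - d := ⟨n - 1 - m, by omega⟩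
  induction d with
  | zero => rw [Nat.sub_zero]; linarith
  | succ d ih =>
    by_cases hd : d < n - 1
    · have h4 := key (n - 1 - (d + 1)) (by omega)
      rw [show n - 1 - (d + 1) + 1 = n - 1 - d by omega, ih (by omega)] at h4
      linarith
    · rw [show n - 1 - (d + 1) = n - 1 - d by omega]
      exact ih (by omega)

variable (hn : 3 ≤ n) (hα : ∀ k l, P.pairingIn ℤ (α k) (α l) = CartanMatrix.D n k l)
include hn hα

theorem coroot_epsilon {k : ℕ} (hk : k + 1 < n) {m : ℕ} (hm : m < n) :
    P.coroot' (α ⟨k, by omega⟩) (epsilon P α m) = delta k m - delta (k + 1) m := by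
  refine map_epsilon (by omega) _ (fun m => delta k m - delta (k + 1) m) (fun m hm => ?_) ?_ hm
  all_goals
    rw [← cast_pairingIn, hα]
    simp only [CartanMatrix.D, Matrix.of_apply, delta, Fin.ext_iff]
    split_ifs <;> first | omega | norm_num

theorem coroot_epsilon_last {m : ℕ} (hm : m < n) :
    P.coroot' (α ⟨n - 1, by omega⟩) (epsilon P α m) = delta (n - 2) m + delta (n - 1) m := by
  refine map_epsilon (by omega) _ (fun m => delta (n - 2) m + delta (n - 1) m) (fun m hm => ?_) ?_
    hm
  all_goals
    rw [← cast_pairingIn, hα]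
    simp only [CartanMatrix.D, Matrix.of_apply, delta, Fin.ext_iff]
    split_ifs <;> first | omega | norm_num

/-- The root `εₖ + εₖ₊₁`, together with its coroot as a functional. For `k = n - 2` it is the last
simple root, and it is obtained from `εₖ₊₁ + εₖ₊₂` by adding `αₖ` and `αₖ₊₁`. -/
theorem exists_root_eq_epsilon_add {k : ℕ} (hk : k + 1 < n) :
    ∃ β, P.root β = epsilon P α k + epsilon P α (k + 1) ∧ ∀ m < n,
      P.coroot' β (epsilon P α m) = delta k m + delta (k + 1) m := by
  obtain ⟨d, rfl⟩ : ∃ d, k = n - 2 - d := ⟨n - 2 - k, by omega⟩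
  induction d with
  | zero =>
    refine ⟨α ⟨n - 1, by omega⟩, ?_, fun m hm => ?_⟩
    · rw [root_eq_epsilon_add (by omega), Nat.sub_zero, show n - 2 + 1 = n - 1 by omega]
    · rw [coroot_epsilon_last hn hα hm, Nat.sub_zero, show n - 2 + 1 = n - 1 by omega]
  | succ d ih =>
    by_cases hd : d < n - 2
    · obtain ⟨β, h1, h2⟩ := ih (by omega)
      generalize hk' : n - 2 - (d + 1) = k at *
      rw [show n - 2 - d = k + 1 by omega] at h1 h2
      have h3 : P.coroot' β (P.root (α ⟨k, by omega⟩)) = -1 := by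
        rw [root_eq_epsilon_sub (by omega), map_sub, h2 _ (by omega), h2 _ (by omega)]
        simp only [delta]
        split_ifs <;> first | omega | norm_num
      obtain ⟨γ, h4, h5⟩ := exists_root_add h3
      have h6 : P.coroot' γ (P.root (α ⟨k + 1, by omega⟩)) = -1 := by
        rw [h5, root_eq_epsilon_sub (by omega), map_sub, map_sub, h2 _ (by omega),
          h2 _ (by omega), coroot_epsilon hn hα (by omega) (by omega),
          coroot_epsilon hn hα (by omega) (by omega)]
        simp only [delta]
        split_ifs <;> first | omega | norm_num
      obtain ⟨ζ, h7, h8⟩ := exists_root_add h6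
      refine ⟨ζ, ?_, fun m hm => ?_⟩
      · rw [h7, h4, h1, root_eq_epsilon_sub (by omega), root_eq_epsilon_sub (by omega)]
        abel
      · rw [h8, h5, h2 m hm, coroot_epsilon hn hα (by omega) hm,
          coroot_epsilon hn hα (by omega) hm]
        ring
    · rw [show n - 2 - (d + 1) = n - 2 - d by omega]
      exact ih (by omega)

/-- In type `D` the roots `εₖ ± εₖ₊₁`, for `k` even, are pairwise orthogonal, and the product of
their reflections maps `εₘ` to `-εₘ`, except for `m = n - 1` if `n` is odd. -/
theorem exists_orthogonal_epsilon :
    ∃ β : Fin (n / 2) ⊕ Fin (n / 2) → ι,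
      (∀ j j', j ≠ j' → P.pairingIn ℤ (β j) (β j') = 0) ∧
      ∀ m < n, sumReflections P β (epsilon P α m) =
        if m / 2 < n / 2 then (2 : ℚ) • epsilon P α m else 0 := by
  choose β hβ hβ' using fun k : Fin (n / 2) =>
    exists_root_eq_epsilon_add hn hα (k := 2 * k) (by omega)
  have h1 : ∀ k : Fin (n / 2), P.root (α ⟨2 * k, by omega⟩) =
      epsilon P α (2 * k) - epsilon P α (2 * k + 1) := fun k => root_eq_epsilon_sub (by omega)
  have h2 : ∀ (k : Fin (n / 2)), ∀ m < n, P.coroot' (α ⟨2 * k, by omega⟩) (epsilon P α m) =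
      delta (2 * k) m - delta (2 * k + 1) m :=
    fun k m hm => coroot_epsilon hn hα (by omega) hm
  refine ⟨Sum.elim (fun k => α ⟨2 * k, by omega⟩) β, fun j j' hj => ?_, fun m hm => ?_⟩
  · suffices h : (P.pairingIn ℤ (Sum.elim (fun k : Fin (n / 2) => α ⟨2 * k, by omega⟩) β j)
        (Sum.elim (fun k : Fin (n / 2) => α ⟨2 * k, by omega⟩) β j') : ℚ) = 0 by exact_mod_cast h
    rw [cast_pairingIn]
    rcases j with j | j <;> rcases j' with j' | j' <;>
      simp only [Sum.elim_inl, Sum.elim_inr, h1, hβ, map_add, map_sub, ne_eq, Sum.inl.injEq,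
        Sum.inr.injEq, Fin.ext_iff] at hj ⊢
    · rw [h2 _ _ (by omega), h2 _ _ (by omega)]
      simp only [delta]
      split_ifs <;> first | omega | norm_num
    · rw [hβ' _ _ (by omega), hβ' _ _ (by omega)]
      simp only [delta]
      split_ifs <;> first | omega | norm_num
    · rw [h2 _ _ (by omega), h2 _ _ (by omega)]
      simp only [delta]
      split_ifs <;> first | omega | norm_num
    · rw [hβ' _ _ (by omega), hβ' _ _ (by omega)]
      simp only [delta]
      split_ifs <;> first | omega | norm_num
  · rw [sumReflections_apply, Fintype.sum_sum_type, ← Finset.sum_add_distrib]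
    simp only [Sum.elim_inl, Sum.elim_inr, h1, hβ, h2 _ m hm, hβ' _ m hm]
    split_ifs with h
    · rw [Finset.sum_eq_single ⟨m / 2, h⟩]
      · rcases Nat.even_or_odd' m with ⟨k, rfl | rfl⟩
        · dsimp only
          rw [show 2 * k / 2 = k by omega]
          simp only [delta, if_true, if_neg (show 2 * k ≠ 2 * k + 1 by omega)]
          module
        · dsimp only
          rw [show (2 * k + 1) / 2 = k by omega]
          simp only [delta, if_true, if_neg (show 2 * k + 1 ≠ 2 * k by omega)]
          module
      · intro k _ hk
        have h3 : (k : ℕ) ≠ m / 2 := fun h => hk (Fin.ext h)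
        simp only [delta, if_neg (show m ≠ 2 * k by omega), if_neg (show m ≠ 2 * k + 1 by omega)]
        simp
      · simp
    · refine Finset.sum_eq_zero fun k _ => ?_
      simp only [delta, if_neg (show m ≠ 2 * k by omega), if_neg (show m ≠ 2 * k + 1 by omega)]
      simp

/-- For odd `n` the change of the sign of `εₙ₋₁` interchanges the last two simple roots and fixes
the others. -/
theorem exists_orthogonal_D :
    ∃ β : Fin (n / 2) ⊕ Fin (n / 2) → ι,
      (∀ j j', j ≠ j' → P.pairingIn ℤ (β j) (β j') = 0) ∧
      ∀ k, P.root (α ((if Odd n then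
        (Equiv.swap ⟨n - 2, by omega⟩ ⟨n - 1, by omega⟩ : Equiv.Perm (Fin n)) else 1) k)) +
          P.root (α k) = ∑ j, P.pairingIn ℤ (α k) (β j) • P.root (β j) := by
  obtain ⟨β, hβ, hT⟩ := exists_orthogonal_epsilon hn hα
  refine ⟨β, hβ, fun k => ?_⟩
  obtain ⟨k, hk⟩ := k
  have hlast := root_eq_epsilon_add (P := P) (α := α) (by omega)
  have hlast' : P.root (α ⟨n - 2, by omega⟩) = epsilon P α (n - 2) - epsilon P α (n - 1) := by
    rw [root_eq_epsilon_sub (by omega), show n - 2 + 1 = n - 1 by omega]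
  rw [← sumReflections_root]
  by_cases hodd : Odd n
  · rw [if_pos hodd]
    have h2 := Nat.odd_iff.1 hodd
    rcases (by omega : k < n - 2 ∨ k = n - 2 ∨ k = n - 1) with h | rfl | rfl
    · rw [Equiv.swap_apply_of_ne_of_ne (by simp [Fin.ext_iff]; omega)
        (by simp [Fin.ext_iff]; omega), root_eq_epsilon_sub (by omega), map_sub, hT _ (by omega),
        hT _ (by omega), if_pos (by omega), if_pos (by omega)]
      module
    · rw [Equiv.swap_apply_left, hlast, hlast', map_sub, hT _ (by omega), hT _ (by omega),
        if_pos (by omega), if_neg (by omega)]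
      module
    · rw [Equiv.swap_apply_right, hlast, hlast', map_add, hT _ (by omega), hT _ (by omega),
        if_pos (by omega), if_neg (by omega)]
      module
  · rw [if_neg hodd, Equiv.Perm.one_apply]
    have h2 : n % 2 = 0 := Nat.even_iff.1 (Nat.not_odd_iff_even.1 hodd)
    rcases (by omega : k + 1 < n ∨ k = n - 1) with h | rfl
    · rw [root_eq_epsilon_sub (by omega), map_sub, hT _ (by omega),
        hT _ (by omega), if_pos (by omega), if_pos (by omega)]
      module
    · rw [hlast, map_add, hT _ (by omega), hT _ (by omega),
        if_pos (by omega), if_pos (by omega)]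
      module

end TypeD

end OrthogonalRoots

/-! ### Conclusion -/

/-- There are pairwise orthogonal roots such that `-1` times the product of their reflections is the
automorphism of the root system that belongs to the given symmetry of the Dynkin diagram. -/
theorem Numbering.exists_orthogonal {ι M N : Type*} [AddCommGroup M] [Module ℚ M] [AddCommGroup N]
    [Module ℚ N] {P : RootPairing ι ℚ M N} [P.IsCrystallographic] [Finite ι] [P.IsReduced]
    [IsSimplyLaced P] {b : P.Base} {X : DynkinType} (ν : Numbering b X) :
    ∃ (J : Type) (_ : Fintype J) (β : J → ι),
      (∀ j j', j ≠ j' → P.pairingIn ℤ (β j) (β j') = 0) ∧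
      ∀ k, P.root (ν.node (X.twist k)) + P.root (ν.node k) =
        ∑ j, P.pairingIn ℤ (ν.node k) (β j) • P.root (β j) := by
  have hα := ν.pairingIn_node
  cases X with
  | A n hn =>
    exact ⟨_, _, exists_orthogonal_A (P := P) (n := n) (α := fun k => ν.node k) hα⟩
  | D n hn =>
    exact ⟨_, _, exists_orthogonal_D (P := P) (n := n) (α := fun k => ν.node k) (by omega) hα⟩
  | E6 => exact ⟨_, _, exists_orthogonal_E6 (P := P) (α := fun k => ν.node k) hα⟩
  | E7 => exact ⟨_, _, exists_orthogonal_E7 (P := P) (α := fun k => ν.node k) hα⟩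
  | E8 => exact ⟨_, _, exists_orthogonal_E8 (P := P) (α := fun k => ν.node k) hα⟩

theorem DynkinType.rank_pos (X : DynkinType) : 0 < X.rank := by
  cases X <;> simp only [rank] <;> omega

end ThreeTransposition

theorem proposition3p2
    (X : ThreeTransposition.DynkinType)
    {ι M N : Type*} [Finite ι] [AddCommGroup M] [Module ℚ M] [AddCommGroup N] [Module ℚ N]
    (P : RootPairing ι ℚ M N) [P.IsRootSystem] [P.IsCrystallographic] [P.IsReduced]
    (b : P.Base) (ν : ThreeTransposition.Numbering b X)
    {K 𝔤 : Type*} [Field K] (hK : Nat.card K = 4) [Algebra (ZMod 2) K]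
    [LieRing 𝔤] [LieAlgebra K 𝔤] [LieAlgebra (ZMod 2) 𝔤] [IsScalarTower (ZMod 2) K 𝔤]
    (c : ThreeTransposition.ChevalleyBasis b K 𝔤) :
    -- `D` is a conjugacy class of `3`-transpositions in `G`
    ThreeTransposition.IsClass c.group c.transpositions ∧
    -- `A(D) / V(D)`, with the product induced from `A(D)`, is isomorphic to `𝔤₂ / Z(𝔤₂)`
    (∃ φ : (ThreeTransposition.Alg c.transpositions ⧸
          ThreeTransposition.vanishing c.transpositions) ≃ₗ[ZMod 2]
        (c.gTwo ⧸ LieAlgebra.center (ZMod 2) c.gTwo),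
      ∀ Y Z : ThreeTransposition.Alg c.transpositions,
        φ (Submodule.Quotient.mk (ThreeTransposition.mul c.transpositions Y Z)) =
          ⁅φ (Submodule.Quotient.mk Y), φ (Submodule.Quotient.mk Z)⁆) ∧
    -- the type of `𝔤₂` over `𝔽₂`
    ∃ σ : 𝔤 ≃ₗ⁅ZMod 2⁆ 𝔤,
      c.IsTwistedFrobenius (ν.node.symm.trans (X.twist.trans ν.node)) σ ∧
      Nonempty (c.gTwo ≃ₗ⁅ZMod 2⁆ ThreeTransposition.ChevalleyBasis.fixedPoints σ) := by
  have := ν.isSimplyLaced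
  have := ν.isWeylTransitive
  have : Fact (Nat.card K = 4) := ⟨hK⟩
  have : CharP K 2 := charP_of_injective_algebraMap (algebraMap (ZMod 2) K).injective 2
  have : Nonempty ι := ⟨ν.node ⟨0, X.rank_pos⟩⟩
  obtain ⟨J, _, β, hβ, hτ⟩ := ν.exists_orthogonal
  refine ⟨c.isClass, c.exists_quotient_equiv,
    c.exists_isTwistedFrobenius β hβ _ fun i => ?_⟩
  obtain ⟨k, rfl⟩ := ν.node.surjective i
  simpa using hτ k
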